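/- **Setting.** Let $d,m\in\mathbb N$, let $f_\alpha:\mathbb R^m\to\mathbb R^m$ ($\alpha\in[d]$) be $C^\infty$, and let $y\in\mathbb R^m$. Let $\mathcal T$ be the set of non-planar rooted trees with vertices decorated by $[d]$, $\mathcal F$ the set of forests (finite multisets of trees, with product $\odot$ and empty forest $\mathbf 1$), $|F|$ the number of vertices of $F$, and $\mathcal H_{BCK}=\mathrm{Span}_{\mathbb R}(\mathcal F)$ with full linear dual $\mathcal H^*_{BCK}$. The symmetry factors are $S(F)=\prod_j r_j!\,S(\sigma_j)^{r_j}$ for $F=\prod_j\sigma_j^{\odot r_j}$ with pairwise different trees $\sigma_j$, and $S(\tau)=S(F)$ if $\tau$ is obtained by joining the roots of the trees of $F$ to a new root. Dual forests are paired by $\langle F_1^*,F_2\rangle=\delta_{F_1,F_2}S(F_2)$. For forests $F=\sigma_1\odot\dots\odot\sigma_n$ and $G$, the simultaneous grafting of $F$ onto $G$ is the sum, over all families $v_1,\dots,v_n$ of (not necessarily distinct) vertices of $G$, of the forest obtained by adding an edge from the root of $\sigma_i$ to $v_i$ for each $i$. The product $F\star_{BCK}G$ is $\sum_{I\sqcup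 J=\{1,\dots,n\}}\big(\prod_{i\in I}^{\odot}\sigma_i\big)\odot\big(\text{simultaneous grafting of }\prod_{j\in J}^{\odot}\sigma_j\text{ onto }G\big)$. It extends bilinearly to $\mathcal H_{BCK}^*$ by $Z=\sum_{F}\frac{\langle Z,F\rangle}{S(F)}F^*$; on each forest only finitely many terms contribute. If $\tau$ has a root decorated by $\alpha$ and branches $\tau_1,\dots,\tau_n$, its elementary differential is $$\Upsilon_f[\tau](y)=\sum_{b\in[m]^n}\partial_{b_1}\cdots\partial_{b_n}f_\alpha(y)\prod_{i=1}^n\Upsilon_f^{b_i}[\tau_i](y).$$ The B-series of $Z\in\mathcal H^*_{BCK}$ and its truncations ($N\in\mathbb N$) are $$B_{\mathcal T}(y,Z)=y+\sum_{\tau\in\mathcal T}\frac{\Upsilon_f[\tau](y)}{S(\tau)}\langle Z,\tau\rangle,\qquad B^{\le N}_{\mathcal T}(y,Z)=y+\sum_{|\tau|\le N}\frac{\Upsilon_f[\tau](y)}{S(\tau)}\langle Z,\tau\rangle .$$ For $\varepsilon\in\mathbb R$ let $\langle\delta_\varepsilon Z,F\rangle=\varepsilon^{|F|}\langle Z,F\rangle$,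 and let $|Z|\in\mathcal H^*_{BCK}$ be given by $\langle|Z|,F\rangle=|\langle Z,F\rangle|$ for $F\in\mathcal F$. **Proposition.** Let $Z^1,Z^2\in\mathcal H^*_{BCK}$, where $Z^1$ is a character (unital and multiplicative for $\odot$) and $\langle Z^2,\mathbf 1\rangle=1$ (for example, $Z^2$ is a character). Then $$B_{\mathcal T}(B_{\mathcal T}(y,Z^1),Z^2)=B_{\mathcal T}(y,Z^1\star_{BCK}Z^2)$$ in the following two senses. 1. *As formal series graded by the number of vertices:* for every $N\in\mathbb N$, as $\varepsilon\to0$, $$B^{\le N}_{\mathcal T}\big(B^{\le N}_{\mathcal T}(y,\delta_\varepsilon Z^1),\delta_\varepsilon Z^2\big)=B^{\le N}_{\mathcal T}\big(y,\delta_\varepsilon(Z^1\star_{BCK}Z^2)\big)+O(\varepsilon^{N+1}).$$ 2. *As an equality in $\mathbb R^m$, when the series converge:* suppose that for some $R\in(0,\infty]$ every $f_\alpha$ has an expansion $f_\alpha(y+v)=\sum_{n\ge0}p_n^\alpha(v,\dots,v)$ for $\|v\|<R$ with $n$-linear maps $p_n^\alpha$ such that $\sum_n\|p^\alpha_n\|r^n<\infty$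 for all $0\le r<R$, that the series $B_{\mathcal T}(y,|Z^1|\star_{BCK}|Z^2|)$ converges absolutely, and that $B_{\mathcal T}(y,Z^1)$, which then converges absolutely, lies in the open ball of radius $R$ around $y$. Then the series $B_{\mathcal T}(B_{\mathcal T}(y,Z^1),Z^2)$ and $B_{\mathcal T}(y,Z^1\star_{BCK}Z^2)$ also converge absolutely, and they are equal. -/

import Mathlib

open scoped ContDiff Topology ENNReal Nat Asymptotics

noncomputable section

namespace BCK

/-! ### Non-planar decorated rooted trees and forests -/

/-- Planar rooted trees whose vertices are decorated by `A`: a root decorated by `a`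
together with the list of the planar trees attached to it. -/
inductive PTree (A : Type) : Type
  | node (a : A) (children : List (PTree A)) : PTree A

namespace PTree

variable {A : Type}

/-- Induction principle: a property of planar trees that passes from the members of a list of
trees to every tree with these children holds for all planar trees. -/
theorem ind {P : PTree A → Prop} (h : ∀ a l, (∀ t ∈ l, P t) → P (node a l)) : ∀ t, P t :=
  fun t => PTree.rec (motive_1 := P) (motive_2 := fun l => ∀ t ∈ l, P t)
    (fun a l hl => h a l hl) (by simp)
    (fun t l ht hl s hs => by
      rcases List.mem_cons.1 hs with rfl | hs
      · exact ht
      · exact hl s hs) t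

mutual
  /-- Two planar trees are equivalent if they represent the same non-planar tree. -/
  inductive Iso : PTree A → PTree A → Prop
    | node (a : A) {l l' : List (PTree A)} : IsoList l l' → Iso (node a l) (node a l')
  /-- Two lists of planar trees are equivalent if, up to the order of their members,
  their members are equivalent as trees. -/
  inductive IsoList : List (PTree A) → List (PTree A) → Prop
    | nil : IsoList [] []
    | cons {t t' : PTree A} {l l' : List (PTree A)} :
        Iso t t' → IsoList l l' → IsoList (t :: l) (t' :: l')
    | swap (t s : PTree A) (l : List (PTree A)) : IsoList (t :: s :: l) (s :: t :: l)
    | trans {l₁ l₂ l₃ : List (PTree A)} : IsoList l₁ l₂ → IsoList l₂ l₃ → IsoList l₁ l₃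
end

theorem IsoList.refl_of {l : List (PTree A)} (h : ∀ t ∈ l, Iso t t) : IsoList l l := by
  induction l with
  | nil => exact .nil
  | cons t l ih => exact .cons (h t (by simp)) (ih fun s hs => h s (by simp [hs]))

theorem Iso.refl (t : PTree A) : Iso t t := by
  induction t using PTree.ind with
  | h a l ih => exact .node a (IsoList.refl_of ih)

theorem Iso.symm {t s : PTree A} (h : Iso t s) : Iso s t :=
  Iso.rec (motive_1 := fun t s _ => Iso s t) (motive_2 := fun l l' _ => IsoList l' l)
    (fun a _ _ _ h => .node a h) .nil (fun _ _ h h' => .cons h h') (fun t s l => .swap s t l)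
    (fun _ _ h h' => .trans h' h) h

theorem Iso.trans {t s r : PTree A} (h : Iso t s) (h' : Iso s r) : Iso t r := by
  cases h with
  | node a hl => cases h' with
    | node _ hl' => exact .node a (hl.trans hl')

/-- Planar trees up to the order of the branches. -/
instance setoid (A : Type) : Setoid (PTree A) := ⟨Iso, Iso.refl, Iso.symm, Iso.trans⟩

mutual
  /-- The number of vertices of a planar tree. -/
  def size : PTree A → ℕ
    | node _ l => sizeList l + 1
  /-- The number of vertices of a list of planar trees. -/
  def sizeList : List (PTree A) → ℕ
    | [] => 0
    | t :: l => size t + sizeList l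
end

theorem Iso.size_eq {t s : PTree A} (h : Iso t s) : size t = size s :=
  Iso.rec (motive_1 := fun t s _ => size t = size s)
    (motive_2 := fun l l' _ => sizeList l = sizeList l')
    (fun a _ _ _ h => by simp [size, h]) rfl (fun _ _ h h' => by simp [sizeList, h, h'])
    (fun t s l => by simp only [sizeList]; omega) (fun _ _ h h' => h.trans h') h

mutual
  /-- The vertices of a planar tree: the root (`none`) or a vertex of one of the branches. -/
  def Vertex : PTree A → Type
    | node _ l => Option (VertexList l)
  /-- The vertices of a list of planar trees. -/
  def VertexList : List (PTree A) → Type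
    | [] => Empty
    | t :: l => Vertex t ⊕ VertexList l
end

mutual
  /-- A tree has finitely many vertices. -/
  instance fintypeVertex : (t : PTree A) → Fintype (Vertex t)
    | node _ l => letI := fintypeVertexList l; inferInstanceAs (Fintype (Option (VertexList l)))
  /-- A list of trees has finitely many vertices. -/
  instance fintypeVertexList : (l : List (PTree A)) → Fintype (VertexList l)
    | [] => inferInstanceAs (Fintype Empty)
    | t :: l =>
      letI := fintypeVertex t
      letI := fintypeVertexList l
      inferInstanceAs (Fintype (Vertex t ⊕ VertexList l))
end

mutual
  /-- `graft t ρ` adds, for every vertex `v` of `t`, edges that connect the roots of the trees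
  in the list `ρ v` to the vertex `v`. -/
  def graft : (t : PTree A) → (Vertex t → List (PTree A)) → PTree A
    | node a l, ρ => node a (ρ none ++ graftList l fun v => ρ (some v))
  /-- `graftList l ρ` adds, for every vertex `v` of a tree of the list `l`, edges that connect the
  roots of the trees in the list `ρ v` to the vertex `v`. -/
  def graftList : (l : List (PTree A)) → (VertexList l → List (PTree A)) → List (PTree A)
    | [], _ => []
    | t :: l, ρ => graft t (fun v => ρ (Sum.inl v)) :: graftList l fun v => ρ (Sum.inr v)
end

end PTree

/-- Non-planar rooted trees with vertices decorated by `[d]`. -/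
abbrev RTree (d : ℕ) : Type := Quotient (PTree.setoid (Fin d))

/-- Forests of non-planar rooted trees; the sum of multisets is the forest product `⊙` and
`0` is the empty forest. -/
abbrev Forest (d : ℕ) : Type := Multiset (RTree d)

variable {d : ℕ}

/-- The number of vertices of a tree. -/
def RTree.size (τ : RTree d) : ℕ := Quotient.lift PTree.size (fun _ _ => PTree.Iso.size_eq) τ

/-- The number of vertices of a forest. -/
def Forest.size (F : Forest d) : ℕ := (F.map RTree.size).sum

/-- The forest of non-planar trees that a list of planar trees represents. -/
def toForest (l : List (PTree (Fin d))) : Forest d := (l.map (Quotient.mk _) : List (RTree d))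

/-- A list of planar trees that represents a given forest. -/
def Forest.reps (F : Forest d) : List (PTree (Fin d)) := F.toList.map Quotient.out

theorem toForest_reps (F : Forest d) : toForest F.reps = F := by
  simp [toForest, Forest.reps, List.map_map, Function.comp_def]

theorem toForest_eq_of_isoList {l l' : List (PTree (Fin d))} (h : PTree.IsoList l l') :
    toForest l = toForest l' :=
  PTree.IsoList.rec (motive_1 := fun t s _ => (Quotient.mk _ t : RTree d) = Quotient.mk _ s)
    (motive_2 := fun l l' _ => toForest l = toForest l')
    (fun a _ _ hl _ => Quotient.sound (PTree.Iso.node a hl)) rfl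
    (fun {t t' l l'} _ _ h h' => by
      have h₁ : ∀ (s : PTree (Fin d)) k, toForest (s :: k) = (Quotient.mk _ s : RTree d) ::ₘ
        toForest k := fun _ _ => rfl
      rw [h₁, h₁, h, h'])
    (fun t s l => Multiset.coe_eq_coe.2 (List.Perm.swap _ _ _)) (fun _ _ h h' => h.trans h') h

/-! ### Symmetry factors -/

open scoped Classical in
/-- The product of `r!` over the isomorphism classes of the trees of a forest, where `r` is the
number of the trees in the class. -/
def Forest.multiplicity (F : Forest d) : ℕ := ∏ τ ∈ F.toFinset, (F.count τ)!

mutual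
  /-- The symmetry factor of a planar tree, as a non-planar tree. -/
  def PTree.symmFactor : PTree (Fin d) → ℕ
    | .node _ l => (toForest l).multiplicity * PTree.symmFactorProd l
  /-- The product of the symmetry factors of the trees in a list. -/
  def PTree.symmFactorProd : List (PTree (Fin d)) → ℕ
    | [] => 1
    | t :: l => PTree.symmFactor t * PTree.symmFactorProd l
end

theorem PTree.Iso.symmFactor_eq {t s : PTree (Fin d)} (h : PTree.Iso t s) :
    t.symmFactor = s.symmFactor :=
  PTree.Iso.rec (motive_1 := fun t s _ => t.symmFactor = s.symmFactor)
    (motive_2 := fun l l' _ => symmFactorProd l = symmFactorProd l')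
    (fun a _ _ hl h => by simp only [symmFactor, h, toForest_eq_of_isoList hl]) rfl
    (fun _ _ h h' => by simp only [symmFactorProd, h, h'])
    (fun t s l => by simp only [symmFactorProd]; ring) (fun _ _ h h' => h.trans h') h

/-- The symmetry factor `S(τ)` of a tree. -/
def RTree.symmFactor (τ : RTree d) : ℕ :=
  Quotient.lift PTree.symmFactor (fun _ _ => PTree.Iso.symmFactor_eq) τ

open scoped Classical in
/-- The symmetry factor `S(F) = ∏ⱼ rⱼ! S(σⱼ) ^ rⱼ` of a forest that consists, for each `j`,
of `rⱼ` copies of `σⱼ`, with pairwise different `σⱼ`. -/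
def Forest.symmFactor (F : Forest d) : ℕ :=
  ∏ τ ∈ F.toFinset, (F.count τ)! * τ.symmFactor ^ F.count τ

theorem symmFactorProd_eq (l : List (PTree (Fin d))) :
    PTree.symmFactorProd l = ((toForest l).map RTree.symmFactor).prod := by
  induction l with
  | nil => simp [PTree.symmFactorProd, toForest]
  | cons t l ih =>
    have h : toForest (t :: l) = (Quotient.mk _ t : RTree d) ::ₘ toForest l := rfl
    rw [PTree.symmFactorProd, ih, h, Multiset.map_cons, Multiset.prod_cons]
    rfl

/-- The symmetry factor of a tree with a root decorated by `a` to which the trees of a forest are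
attached is the symmetry factor of that forest. -/
theorem symmFactor_mk_node (a : Fin d) (l : List (PTree (Fin d))) :
    RTree.symmFactor (Quotient.mk _ (.node a l)) = (toForest l).symmFactor := by
  classical
  change (toForest l).multiplicity * PTree.symmFactorProd l = _
  rw [symmFactorProd_eq, Forest.multiplicity, Forest.symmFactor, Finset.prod_mul_distrib,
    Finset.prod_multiset_map_count]

/-! ### The Butcher-Connes-Kreimer algebra and its dual -/

/-- The linear span of the forests, a commutative algebra for the forest product. -/
abbrev HBCK (d : ℕ) : Type := AddMonoidAlgebra ℝ (Forest d)

/-- The forest `F` as an element of the span of the forests. -/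
def ofForest (F : Forest d) : HBCK d := AddMonoidAlgebra.single F 1

/-- The space `H*_BCK` of all linear functionals on the span of the forests. -/
abbrev HDual (d : ℕ) : Type := Module.Dual ℝ (HBCK d)

/-- The linear functional with prescribed values on the forests. -/
def HDual.ofValues (c : Forest d → ℝ) : HDual d :=
  Finsupp.linearCombination ℝ c ∘ₗ (AddMonoidAlgebra.coeffLinearEquiv ℝ).toLinearMap

theorem HDual.ofValues_ofForest (c : Forest d → ℝ) (F : Forest d) :
    HDual.ofValues c (ofForest F) = c F := by
  simp [HDual.ofValues, ofForest]

/-- A character: a functional that is multiplicative for the forest product and unital. -/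
def HDual.IsCharacter (Z : HDual d) : Prop :=
  Z 1 = 1 ∧ ∀ h₁ h₂ : HBCK d, Z (h₁ * h₂) = Z h₁ * Z h₂

/-- The functional on the span of the forests given by a finite combination of the dual
forests `F*`, by the pairing `⟨F₁*, F₂⟩ = δ S(F₂)`. -/
def pairing (x : HBCK d) : HDual d := HDual.ofValues fun F => x.coeff F * F.symmFactor

open scoped Classical in
/-- The simultaneous grafting of the forest `F = σ₁ ⊙ ⋯ ⊙ σₙ` onto the forest `G`: the sum over all
families `v₁, …, vₙ` of vertices of `G`, not necessarily distinct, of the forest obtained by adding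
an edge from the root of `σᵢ` to `vᵢ` for every `i`. It is computed with planar representatives;
other representatives give the same sum. -/
def simGraft (F G : Forest d) : HBCK d :=
  ∑ v : Fin F.reps.length → PTree.VertexList G.reps,
    ofForest (toForest (PTree.graftList G.reps fun w =>
      ((List.finRange F.reps.length).filter fun i => v i = w).map F.reps.get))

/-- The product `F ⋆ G` of two (dual) forests: the sum over all ways to distribute the
trees of `F` into two parts (the terms of the unshuffle coproduct of `F`) of the forest product
of the first part with the simultaneous grafting of the second part onto `G`. -/
def starForest (F G : Forest d) : HBCK d :=
  ((Multiset.antidiagonal F).map fun p => ofForest p.1 * simGraft p.2 G).sum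

/-- The product `⋆` on `H*_BCK`: the bilinear extension of the product of forests to the
series `Z = ∑ (⟨Z, F⟩ / S(F)) F*`. On each forest only finitely many terms do not vanish, since
every forest in `F ⋆ G` has as many vertices as `F` and `G` together. -/
def star (Z₁ Z₂ : HDual d) : HDual d := HDual.ofValues fun K =>
  ∑ᶠ p : Forest d × Forest d, (Z₁ (ofForest p.1) / p.1.symmFactor) *
    (Z₂ (ofForest p.2) / p.2.symmFactor) * pairing (starForest p.1 p.2) (ofForest K)

/-- The dilation `⟨δ_ε Z, F⟩ = ε ^ |F| ⟨Z, F⟩` by the number `|F|` of vertices. -/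
def HDual.dilate (ε : ℝ) (Z : HDual d) : HDual d :=
  HDual.ofValues fun F => ε ^ F.size * Z (ofForest F)

/-- The functional `|Z|` with `⟨|Z|, F⟩ = |⟨Z, F⟩|` for all forests `F`. -/
def HDual.abs (Z : HDual d) : HDual d := HDual.ofValues fun F => |Z (ofForest F)|

/-! ### Elementary differentials and B-series -/

/-- The space `ℝᵐ`. -/
abbrev Space (m : ℕ) : Type := EuclideanSpace ℝ (Fin m)

variable {m : ℕ}

mutual
  /-- The elementary differential of a planar tree with a root decorated by `a` and branches
  `τ₁, …, τₙ`, at `y`: the `n`-th derivative of `f a` at `y` in the directions of the elementary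
  differentials of the branches at `y`. -/
  def PTree.elemDiff (f : Fin d → Space m → Space m) (y : Space m) : PTree (Fin d) → Space m
    | .node a l => iteratedFDeriv ℝ l.length (f a) y (PTree.elemDiffList f y l)
  /-- The elementary differentials of the trees in a list. -/
  def PTree.elemDiffList (f : Fin d → Space m → Space m) (y : Space m) :
      (l : List (PTree (Fin d))) → Fin l.length → Space m
    | [] => Fin.elim0
    | t :: l => Fin.cons (PTree.elemDiff f y t) (PTree.elemDiffList f y l)
end

/-- The elementary differential `Υ_f[τ](y)`, computed with a planar representative of `τ`; for
smooth `f` it does not depend on the representative, since partial derivatives commute. -/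
def elemDiff (f : Fin d → Space m → Space m) (τ : RTree d) (y : Space m) : Space m :=
  PTree.elemDiff f y τ.out

/-- The term `(Υ_f[τ](y) / S(τ)) ⟨Z, τ⟩` of the B-series. -/
def bTerm (f : Fin d → Space m → Space m) (y : Space m) (Z : HDual d) (τ : RTree d) : Space m :=
  (Z (ofForest {τ}) / τ.symmFactor) • elemDiff f τ y

/-- The B-series `B_T(y, Z) = y + ∑_τ (Υ_f[τ](y) / S(τ)) ⟨Z, τ⟩`, over all trees `τ`. -/
def bSeries (f : Fin d → Space m → Space m) (y : Space m) (Z : HDual d) : Space m :=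
  y + ∑' τ : RTree d, bTerm f y Z τ

/-- The B-series converges absolutely. -/
def BSeriesConverges (f : Fin d → Space m → Space m) (y : Space m) (Z : HDual d) : Prop :=
  Summable fun τ : RTree d => ‖bTerm f y Z τ‖

/-- The B-series truncated to the (finitely many) trees with at most `N` vertices. -/
def bSeriesTrunc (f : Fin d → Space m → Space m) (N : ℕ) (y : Space m) (Z : HDual d) : Space m :=
  y + ∑ᶠ τ ∈ {τ : RTree d | τ.size ≤ N}, bTerm f y Z τ

/-! ### Consistency of the definitions -/

theorem PTree.elemDiffList_eq (f : Fin d → Space m → Space m) (y : Space m)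
    (l : List (PTree (Fin d))) (i : Fin l.length) :
    PTree.elemDiffList f y l i = PTree.elemDiff f y (l.get i) := by
  induction l with
  | nil => exact i.elim0
  | cons t l ih =>
    refine Fin.cases ?_ (fun j => ?_) i
    · rfl
    · simpa [PTree.elemDiffList] using ih j

/-- The iterated derivative of `g` in the directions of the members of a list. -/
def dirDeriv (g : Space m → Space m) : List (Space m) → Space m → Space m
  | [] => g
  | v :: l => fun y => fderiv ℝ (dirDeriv g l) y v

theorem contDiff_dirDeriv {g : Space m → Space m} (hg : ContDiff ℝ ∞ g) (l : List (Space m)) :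
    ContDiff ℝ ∞ (dirDeriv g l) := by
  induction l with
  | nil => exact hg
  | cons v l ih => exact (ih.fderiv_right (m := ∞) (by simp)).clm_apply contDiff_const

theorem iteratedFDeriv_eq_dirDeriv {g : Space m → Space m} (hg : ContDiff ℝ ∞ g) {n : ℕ}
    (v : Fin n → Space m) (y : Space m) :
    iteratedFDeriv ℝ n g y v = dirDeriv g (List.ofFn v) y := by
  induction n generalizing y with
  | zero => simp [dirDeriv]
  | succ n ih =>
    rw [iteratedFDeriv_succ_apply_left, List.ofFn_succ, dirDeriv]
    have h : (fun z => iteratedFDeriv ℝ n g z (Fin.tail v)) =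
        dirDeriv g (List.ofFn (Fin.tail v)) := funext fun z => ih _ z
    have hd : DifferentiableAt ℝ (iteratedFDeriv ℝ n g) y :=
      (hg.differentiable_iteratedFDeriv (by exact_mod_cast ENat.natCast_lt_top n)) y
    change _ = fderiv ℝ (dirDeriv g (List.ofFn (Fin.tail v))) y (v 0)
    rw [← h, fderiv_continuousMultilinear_apply_const_apply hd]

theorem dirDeriv_perm {g : Space m → Space m} (hg : ContDiff ℝ ∞ g) {l l' : List (Space m)}
    (h : l.Perm l') : dirDeriv g l = dirDeriv g l' := by
  induction h with
  | nil => rfl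
  | cons v _ ih => simp only [dirDeriv, ih]
  | trans _ _ ih ih' => exact ih.trans ih'
  | swap v w l =>
    funext y
    have hc := contDiff_dirDeriv hg l
    have hd : DifferentiableAt ℝ (fderiv ℝ (dirDeriv g l)) y :=
      ((hc.fderiv_right (m := ∞) (by simp)).differentiable (by simp)) y
    simp only [dirDeriv]
    rw [fderiv_clm_apply hd (differentiableAt_const _), fderiv_clm_apply hd
      (differentiableAt_const _)]
    simpa using (hc.contDiffAt (x := y)).isSymmSndFDerivAt
      (by rw [minSmoothness_of_isRCLikeNormedField]; exact WithTop.coe_le_coe.2 (le_top : (2 : ℕ∞) ≤ ⊤)) w v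

theorem PTree.elemDiff_node {f : Fin d → Space m → Space m} (hf : ∀ a, ContDiff ℝ ∞ (f a))
    (y : Space m) (a : Fin d) (l : List (PTree (Fin d))) :
    PTree.elemDiff f y (.node a l) = dirDeriv (f a) (l.map (PTree.elemDiff f y)) y := by
  have h : List.ofFn (PTree.elemDiffList f y l) = l.map (PTree.elemDiff f y) := by
    rw [funext (PTree.elemDiffList_eq f y l)]
    exact List.ext_get (by simp) (by simp)
  rw [PTree.elemDiff, iteratedFDeriv_eq_dirDeriv (hf a), h]

theorem PTree.Iso.elemDiff_eq {f : Fin d → Space m → Space m} (hf : ∀ a, ContDiff ℝ ∞ (f a))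
    (y : Space m) {t s : PTree (Fin d)} (h : PTree.Iso t s) :
    PTree.elemDiff f y t = PTree.elemDiff f y s :=
  PTree.Iso.rec (motive_1 := fun t s _ => PTree.elemDiff f y t = PTree.elemDiff f y s)
    (motive_2 := fun l l' _ =>
      (l.map (PTree.elemDiff f y)).Perm (l'.map (PTree.elemDiff f y)))
    (fun a _ _ _ h => by
      rw [PTree.elemDiff_node hf, PTree.elemDiff_node hf, dirDeriv_perm (hf a) h])
    .nil (fun _ _ h h' => by rw [List.map_cons, List.map_cons, h]; exact h'.cons _)
    (fun t s l => .swap _ _ _) (fun _ _ h h' => h.trans h') h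

/-- The elementary differential of a tree is that of any planar representative. -/
theorem elemDiff_mk {f : Fin d → Space m → Space m} (hf : ∀ a, ContDiff ℝ ∞ (f a))
    (t : PTree (Fin d)) (y : Space m) :
    elemDiff f (Quotient.mk _ t) y = PTree.elemDiff f y t :=
  PTree.Iso.elemDiff_eq hf y (Quotient.mk_out t)

/-- The recursive formula for the elementary differentials in coordinates: for a tree with a root
decorated by `a` and branches `τ₁, …, τₙ` it is the sum over `b ∈ [m]ⁿ` of
`∂_{b₁} ⋯ ∂_{bₙ} f_a(y) ∏ᵢ Υ^{bᵢ}[τᵢ](y)`. -/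
theorem elemDiff_mk_node {f : Fin d → Space m → Space m} (hf : ∀ a, ContDiff ℝ ∞ (f a))
    (a : Fin d) (l : List (PTree (Fin d))) (y : Space m) :
    elemDiff f (Quotient.mk _ (.node a l)) y =
      ∑ b : Fin l.length → Fin m, (∏ i, (elemDiff f (Quotient.mk _ (l.get i)) y) (b i)) •
        iteratedFDeriv ℝ l.length (f a) y fun i => EuclideanSpace.single (b i) (1 : ℝ) := by
  have h : PTree.elemDiffList f y l = fun i => ∑ j : Fin m,
      (elemDiff f (Quotient.mk _ (l.get i)) y) j • EuclideanSpace.single j (1 : ℝ) := by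
    funext i
    rw [PTree.elemDiffList_eq, elemDiff_mk hf]
    ext j
    simp [Finset.sum_apply, Pi.single_apply]
  rw [elemDiff_mk hf, PTree.elemDiff, h, ContinuousMultilinearMap.map_sum]
  exact Finset.sum_congr rfl fun b _ => ContinuousMultilinearMap.map_smul_univ _ _ _

theorem PTree.length_le_sizeList {A : Type} (l : List (PTree A)) :
    l.length ≤ PTree.sizeList l := by
  induction l with
  | nil => simp
  | cons t l ih =>
    have : 1 ≤ PTree.size t := by cases t; simp [PTree.size]
    simp only [List.length_cons, PTree.sizeList]
    omega

theorem PTree.size_le_sizeList {A : Type} {t : PTree A} {l : List (PTree A)} (h : t ∈ l) :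
    PTree.size t ≤ PTree.sizeList l := by
  induction l with
  | nil => simp at h
  | cons s l ih =>
    simp only [PTree.sizeList]
    rcases List.mem_cons.1 h with rfl | h
    · omega
    · have := ih h
      omega

theorem PTree.finite_sizeList_le_of {d N : ℕ} (h : {t : PTree (Fin d) | t.size ≤ N}.Finite) :
    {l : List (PTree (Fin d)) | PTree.sizeList l ≤ N}.Finite := by
  have := h.to_subtype
  refine ((List.finite_length_le {t : PTree (Fin d) | t.size ≤ N} N).image
    (List.map Subtype.val)).subset ?_
  intro l hl
  have hl' : PTree.sizeList l ≤ N := hl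
  exact ⟨l.attach.map fun t => ⟨t.1, (PTree.size_le_sizeList t.2).trans hl'⟩,
    (by simpa using (PTree.length_le_sizeList l).trans hl' : (l.attach.map _).length ≤ N), by simp⟩

theorem PTree.finite_size_le (d N : ℕ) : {t : PTree (Fin d) | t.size ≤ N}.Finite := by
  induction N with
  | zero =>
    refine Set.Finite.subset Set.finite_empty fun t ht => ?_
    cases t
    simp [PTree.size] at ht
  | succ N ih =>
    refine ((Set.finite_univ (α := Fin d)).image2 PTree.node
      (PTree.finite_sizeList_le_of ih)).subset ?_
    rintro ⟨a, l⟩ ht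
    have ht' : PTree.sizeList l ≤ N := by simpa [PTree.size] using ht
    exact ⟨a, trivial, l, ht', rfl⟩

/-- There are finitely many trees with at most `N` vertices. -/
theorem finite_size_le (d N : ℕ) : {τ : RTree d | τ.size ≤ N}.Finite := by
  refine ((PTree.finite_size_le d N).image (Quotient.mk _)).subset fun τ h => ?_
  induction τ using Quotient.ind with
  | _ t => exact ⟨t, h, rfl⟩

theorem PTree.sizeList_append {A : Type} (l l' : List (PTree A)) :
    PTree.sizeList (l ++ l') = PTree.sizeList l + PTree.sizeList l' := by
  induction l with
  | nil => simp [PTree.sizeList]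
  | cons t l ih => simp only [List.cons_append, PTree.sizeList, ih]; omega

theorem PTree.sizeList_eq {A : Type} (l : List (PTree A)) :
    PTree.sizeList l = (l.map PTree.size).sum := by
  induction l with
  | nil => rfl
  | cons t l ih => simp [PTree.sizeList, ih]

theorem PTree.sizeList_graftList {A : Type} (l : List (PTree A))
    (ρ : PTree.VertexList l → List (PTree A)) :
    PTree.sizeList (PTree.graftList l ρ) = PTree.sizeList l + ∑ w, PTree.sizeList (ρ w) :=
  PTree.rec_1 (motive_1 := fun t => ∀ ρ : PTree.Vertex t → List (PTree A),
      PTree.size (PTree.graft t ρ) = PTree.size t + ∑ w, PTree.sizeList (ρ w))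
    (motive_2 := fun l => ∀ ρ : PTree.VertexList l → List (PTree A),
      PTree.sizeList (PTree.graftList l ρ) = PTree.sizeList l + ∑ w, PTree.sizeList (ρ w))
    (fun a l ih ρ => by
      have h : ∑ w, PTree.sizeList (ρ w) =
          PTree.sizeList (ρ none) + ∑ w, PTree.sizeList (ρ (some w)) :=
        Fintype.sum_option (α := PTree.VertexList l) fun w => PTree.sizeList (ρ w)
      rw [h, PTree.graft, PTree.size, PTree.size, PTree.sizeList_append, ih]
      omega)
    (fun ρ => by
      have h : ∑ w, PTree.sizeList (ρ w) = 0 := Fintype.sum_empty (ι := Empty) _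
      rw [h, PTree.graftList]; rfl)
    (fun t l ht hl ρ => by
      have h : ∑ w, PTree.sizeList (ρ w) = ∑ w, PTree.sizeList (ρ (Sum.inl w)) +
          ∑ w, PTree.sizeList (ρ (Sum.inr w)) :=
        Fintype.sum_sum_type (α₁ := PTree.Vertex t) (α₂ := PTree.VertexList l)
          fun w => PTree.sizeList (ρ w)
      rw [h, PTree.graftList, PTree.sizeList, PTree.sizeList, ht, hl]
      omega) l ρ

theorem size_toForest (l : List (PTree (Fin d))) : (toForest l).size = PTree.sizeList l := by
  rw [PTree.sizeList_eq, Forest.size, toForest, Multiset.map_coe, Multiset.sum_coe, List.map_map]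
  rfl

theorem sizeList_reps (F : Forest d) : PTree.sizeList F.reps = F.size := by
  rw [← size_toForest, toForest_reps]

/-- Every forest in the simultaneous grafting of `F` onto `G` has `|F| + |G|` vertices. -/
theorem size_of_mem_simGraft {F G K : Forest d} (h : (simGraft F G).coeff K ≠ 0) :
    K.size = F.size + G.size := by
  classical
  simp only [simGraft, AddMonoidAlgebra.coeff_sum, Finsupp.coe_finsetSum,
    Finset.sum_apply] at h
  obtain ⟨v, -, hv⟩ := Finset.exists_ne_zero_of_sum_ne_zero h
  rw [ofForest, AddMonoidAlgebra.coeff_single, Finsupp.single_apply_ne_zero] at hv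
  rw [hv.1, size_toForest, PTree.sizeList_graftList, sizeList_reps, add_comm]
  congr 1
  have h₁ : ∀ w, PTree.sizeList (((List.finRange F.reps.length).filter fun i => v i = w).map
      F.reps.get) = ∑ i, if v i = w then PTree.size (F.reps.get i) else 0 := by
    intro w
    rw [PTree.sizeList_eq, List.map_map, ← Finset.sum_filter]
    rw [← List.sum_toFinset _ ((List.nodup_finRange _).filter _)]
    exact Finset.sum_congr (by ext; simp) fun _ _ => rfl
  simp_rw [h₁]
  rw [Finset.sum_comm]
  simp only [Finset.sum_ite_eq, Finset.mem_univ, if_true]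
  rw [← sizeList_reps, PTree.sizeList_eq, ← Fin.sum_univ_fun_getElem]
  rfl

/-- Every forest in `F ⋆ G` has `|F| + |G|` vertices. -/
theorem size_of_mem_starForest {F G K : Forest d} (h : (starForest F G).coeff K ≠ 0) :
    K.size = F.size + G.size := by
  classical
  have hs : ∀ s : Multiset (HBCK d), (s.sum).coeff K ≠ 0 → ∃ x ∈ s, x.coeff K ≠ 0 := by
    intro s
    induction s using Multiset.induction with
    | empty => simp
    | cons x s ih =>
      intro hx
      by_contra! hc
      refine hx ?_
      rw [Multiset.sum_cons, AddMonoidAlgebra.coeff_add, Finsupp.add_apply,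
        hc x (Multiset.mem_cons_self _ _), zero_add]
      by_contra h'
      obtain ⟨z, hz, hz'⟩ := ih h'
      exact hz' (hc z (Multiset.mem_cons_of_mem hz))
  obtain ⟨x, hx, hx'⟩ := hs _ h
  obtain ⟨⟨F₁, F₂⟩, hp, rfl⟩ := Multiset.mem_map.1 hx
  rw [Multiset.mem_antidiagonal] at hp
  have hK : ∃ K', K = F₁ + K' ∧ (simGraft F₂ G).coeff K' ≠ 0 := by
    by_cases hd : ∃ K', F₁ + K' = K
    · obtain ⟨K', rfl⟩ := hd
      refine ⟨K', rfl, ?_⟩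
      simpa [ofForest] using hx'
    · push Not at hd
      exact absurd (AddMonoidAlgebra.coeff_single_mul_of_forall_add_ne _ _ hd) hx'
  obtain ⟨K', rfl, hK'⟩ := hK
  have h' := size_of_mem_simGraft hK'
  simp only at hp
  have hadd : ∀ F G : Forest d, (F + G).size = F.size + G.size := fun F G => by
    simp [Forest.size]
  rw [hadd, h', ← hp, hadd, add_assoc]

/-- There are finitely many forests with at most `N` vertices. -/
theorem finite_forest_size_le (d N : ℕ) : {F : Forest d | F.size ≤ N}.Finite := by
  have hl := PTree.finite_sizeList_le_of (PTree.finite_size_le d N)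
  refine (hl.image toForest).subset fun F h => ⟨F.reps, ?_, toForest_reps F⟩
  exact (sizeList_reps F).trans_le h

/-- For every forest `K` only finitely many pairs of forests contribute to `⟨Z₁ ⋆ Z₂, K⟩`. -/
theorem finite_support_star (Z₁ Z₂ : HDual d) (K : Forest d) :
    (Function.support fun p : Forest d × Forest d =>
      (Z₁ (ofForest p.1) / p.1.symmFactor) * (Z₂ (ofForest p.2) / p.2.symmFactor) *
        pairing (starForest p.1 p.2) (ofForest K)).Finite := by
  refine ((finite_forest_size_le d K.size).prod (finite_forest_size_le d K.size)).subset ?_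
  rintro ⟨F, G⟩ h
  have h' : (starForest F G).coeff K ≠ 0 := by
    intro h'
    refine h ?_
    simp [pairing, HDual.ofValues_ofForest, h']
  have := size_of_mem_starForest h'
  exact ⟨(by omega : F.size ≤ K.size), (by omega : G.size ≤ K.size)⟩

end BCK

end

noncomputable section

namespace BCK

variable {d : ℕ} {m : ℕ}

/-! ### Iterated directional derivatives -/

-- The identity is a Taylor expansion combined with the Leibniz rule. Write `x` for the increment of
-- the inner B-series, and expand each `elemDiff f σ` around `y` at `y + x`. The multinomial theorem
-- (`hasSum_dirDeriv`) turns the Taylor series into a sum over forests `F`, with weight one over the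
-- product of the multiplicity factorials. Multiplicativity of `Z₁` makes the total coefficient of
-- `F` equal to `Z₁(F) / S(F)` (`HDual.IsCharacter.apply_div_symmFactor`). By the Leibniz rule,
-- differentiating `elemDiff f σ` in the directions of the elementary differentials of the trees of
-- `F` gives the sum over all simultaneous graftings of `F` onto `σ`
-- (`PTree.dirDeriv_elemDiff_map_elemDiff`).
--
-- On the other side, counting components shows which pairs contribute to `Z₁ ⋆ Z₂` at a tree `τ`:
-- the pairs `(F, {σ})` with all of `F` grafted, and the pair `({τ}, 0)`, which reproduces the inner
-- series because `Z₂ 1 = 1` (`hasSum_star`). Apart from that inner series, both sides are therefore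
-- the same family over triples `(τ, F, σ)`, summed in different orders.
--
-- For the convergent statement (`bSeries_comp`), grafting coefficients are nonnegative, so
-- convergence for `Z₁.abs` and `Z₂.abs` makes the triple family absolutely summable. It remains to
-- see that an absolutely convergent Taylor series has the right sum (`hasSum_taylor_of_summable`).
-- For the formal statement, grafting adds vertex numbers, so the exchange of sums is finite
-- (`sum_bTerm_star`) and the error is a Taylor remainder (`isBigO_sum_forest`).

theorem dirDeriv_append (g : Space m → Space m) (l l' : List (Space m)) :
    dirDeriv g (l ++ l') = dirDeriv (dirDeriv g l') l := by
  induction l with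
  | nil => rfl
  | cons v l ih => simp only [List.cons_append, dirDeriv, ih]

/-- The head of the list is by definition the outermost derivative. Symmetry makes it the innermost
one, so that inductions on the list can replace `g` by its derivative. -/
theorem dirDeriv_cons' {g : Space m → Space m} (hg : ContDiff ℝ ∞ g) (v : Space m)
    (l : List (Space m)) : dirDeriv g (v :: l) = dirDeriv (dirDeriv g [v]) l := by
  rw [← dirDeriv_append]
  exact dirDeriv_perm hg (List.perm_append_singleton v l).symm

/-- When a direction depends on `y`, this expansion moves the dependence into scalar coordinates and
leaves constant directions, so the ordinary product rule applies. -/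
theorem dirDeriv_cons_eq_sum {g : Space m → Space m} (hg : ContDiff ℝ ∞ g) (v : Space m)
    (l : List (Space m)) (y : Space m) :
    dirDeriv g (v :: l) y =
      ∑ j, v j • dirDeriv (dirDeriv g [EuclideanSpace.single j 1]) l y := by
  have hv : v = ∑ j, v j • EuclideanSpace.single j (1 : ℝ) := by
    ext j
    simp [Pi.single_apply]
  conv_lhs => rw [hv]
  change fderiv ℝ (dirDeriv g l) y _ = _
  rw [map_sum]
  refine Finset.sum_congr rfl fun j _ => ?_
  rw [map_smul, ← dirDeriv_cons' hg, dirDeriv]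

theorem dirDeriv_cons_sum (g : Space m → Space m) {ι : Type*} (s : Finset ι) (v : ι → Space m)
    (l : List (Space m)) (y : Space m) :
    dirDeriv g ((∑ i ∈ s, v i) :: l) y = ∑ i ∈ s, dirDeriv g (v i :: l) y := by
  simp only [dirDeriv, map_sum]

theorem norm_dirDeriv_le {g : Space m → Space m} (hg : ContDiff ℝ ∞ g) (l : List (Space m))
    (y : Space m) :
    ‖dirDeriv g l y‖ ≤ ‖iteratedFDeriv ℝ l.length g y‖ * (l.map fun v => ‖v‖).prod := by
  have h := iteratedFDeriv_eq_dirDeriv hg l.get y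
  rw [List.ofFn_get] at h
  rw [← h]
  refine (ContinuousMultilinearMap.le_opNorm _ _).trans_eq ?_
  congr 1
  rw [← List.prod_ofFn]
  congr 1
  exact List.ext_get (by simp) (by simp)

theorem analyticOnNhd_dirDeriv {g : Space m → Space m} {s : Set (Space m)}
    (hg : AnalyticOnNhd ℝ g s) (l : List (Space m)) : AnalyticOnNhd ℝ (dirDeriv g l) s := by
  induction l with
  | nil => exact hg
  | cons v l ih => exact (ContinuousLinearMap.apply ℝ (Space m) v).comp_analyticOnNhd ih.fderiv

theorem analyticOnNhd_dirDeriv_map {s : Set (Space m)} {gs : List (Space m → Space m)}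
    (hs : ∀ h ∈ gs, AnalyticOnNhd ℝ h s) {g : Space m → Space m} (hg : ContDiff ℝ ∞ g)
    (hg' : AnalyticOnNhd ℝ g s) :
    AnalyticOnNhd ℝ (fun y => dirDeriv g (gs.map fun h => h y) y) s := by
  induction gs generalizing g with
  | nil => exact hg'
  | cons h gs ih =>
    simp only [List.map_cons, dirDeriv_cons_eq_sum hg]
    refine Finset.analyticOnNhd_fun_sum _ fun j _ => ?_
    exact ((EuclideanSpace.proj (𝕜 := ℝ) j).comp_analyticOnNhd (hs h (by simp))).smul
      (ih (fun h' hh => hs h' (by simp [hh])) (contDiff_dirDeriv hg _)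
        (analyticOnNhd_dirDeriv hg' _))

theorem PTree.analyticOnNhd_elemDiff {f : Fin d → Space m → Space m}
    (hf : ∀ a, ContDiff ℝ ∞ (f a)) {s : Set (Space m)} (hs : ∀ a, AnalyticOnNhd ℝ (f a) s)
    (t : PTree (Fin d)) : AnalyticOnNhd ℝ (fun y => PTree.elemDiff f y t) s := by
  induction t using PTree.ind with
  | h a l ih =>
    simp only [PTree.elemDiff_node hf]
    have h := analyticOnNhd_dirDeriv_map
      (gs := l.map fun t y => PTree.elemDiff f y t) (by simpa using ih) (hf a) (hs a)
    simpa only [List.map_map, Function.comp_def] using h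

theorem contDiff_dirDeriv_cons {A : Space m → Space m} {B : Space m → List (Space m)}
    (hA : ContDiff ℝ ∞ A)
    (hB : ∀ g : Space m → Space m, ContDiff ℝ ∞ g → ContDiff ℝ ∞ fun y => dirDeriv g (B y) y)
    {g : Space m → Space m} (hg : ContDiff ℝ ∞ g) :
    ContDiff ℝ ∞ fun y => dirDeriv g (A y :: B y) y := by
  simp only [dirDeriv_cons_eq_sum hg]
  exact ContDiff.sum fun j _ => ((EuclideanSpace.proj (𝕜 := ℝ) j).contDiff.comp hA).smul
    (hB _ (contDiff_dirDeriv hg _))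

/-- The product rule for `y ↦ dirDeriv g (A y :: B y) y`. -/
theorem fderiv_dirDeriv_cons {ι κ : Type*} [Fintype ι] [Fintype κ] {A : Space m → Space m}
    {B : Space m → List (Space m)} {y v : Space m} {A' : ι → Space m} {B' : κ → List (Space m)}
    (hA : ContDiff ℝ ∞ A) (hA' : fderiv ℝ A y v = ∑ w, A' w)
    (hB : ∀ g : Space m → Space m, ContDiff ℝ ∞ g → ContDiff ℝ ∞ fun y => dirDeriv g (B y) y)
    (hB' : ∀ g : Space m → Space m, ContDiff ℝ ∞ g → fderiv ℝ (fun y => dirDeriv g (B y) y) y v =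
      dirDeriv g (v :: B y) y + ∑ w, dirDeriv g (B' w) y)
    {g : Space m → Space m} (hg : ContDiff ℝ ∞ g) :
    fderiv ℝ (fun y => dirDeriv g (A y :: B y) y) y v = dirDeriv g (v :: A y :: B y) y +
      (∑ w, dirDeriv g (A' w :: B y) y + ∑ w, dirDeriv g (A y :: B' w) y) := by
  have hc : ∀ j : Fin m, ContDiff ℝ ∞ fun y => A y j := fun j =>
    (EuclideanSpace.proj (𝕜 := ℝ) j).contDiff.comp hA
  have hd : ∀ j : Fin m, fderiv ℝ (fun y => A y j) y v = (∑ w, A' w) j := by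
    intro j
    rw [← hA']
    exact congrArg (fun L : Space m →L[ℝ] ℝ => L v) ((EuclideanSpace.proj (𝕜 := ℝ) j).hasFDerivAt.comp
      y (hA.differentiable (by simp) y).hasFDerivAt).fderiv
  have hB₁ := fun j : Fin m =>
    hB (dirDeriv g [EuclideanSpace.single j 1]) (contDiff_dirDeriv hg _)
  have hB₂ := fun j : Fin m =>
    hB' (dirDeriv g [EuclideanSpace.single j 1]) (contDiff_dirDeriv hg _)
  rw [funext fun y => dirDeriv_cons_eq_sum hg (A y) (B y) y]
  rw [fderiv_fun_sum fun (j : Fin m) _ => by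
    exact ((hc j).smul (hB₁ j)).differentiable (by simp) y, sum_apply]
  have hj : ∀ j, fderiv ℝ (fun y => A y j •
        dirDeriv (dirDeriv g [EuclideanSpace.single j 1]) (B y) y) y v =
      (∑ w, A' w) j • dirDeriv (dirDeriv g [EuclideanSpace.single j 1]) (B y) y +
      (A y j • dirDeriv (dirDeriv g [EuclideanSpace.single j 1]) (v :: B y) y +
      ∑ w, A y j • dirDeriv (dirDeriv g [EuclideanSpace.single j 1]) (B' w) y) := by
    intro j
    rw [fderiv_fun_smul ((hc j).differentiable (by simp) y)
      ((hB₁ j).differentiable (by simp) y)]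
    simp only [add_apply, smul_apply, ContinuousLinearMap.smulRight_apply]
    rw [hd, hB₂, smul_add, Finset.smul_sum, add_comm]
  simp only [hj, Finset.sum_add_distrib]
  rw [Finset.sum_comm (s := Finset.univ) (t := Finset.univ)]
  -- Folding the coordinate sums back recovers the directions; the term in which the derivative
  -- falls on `g` appears as `A y :: v :: B y`.
  simp only [← dirDeriv_cons_eq_sum hg]
  rw [dirDeriv_cons_sum, dirDeriv_perm hg (List.Perm.swap v (A y) (B y))]
  abel

/-! ### The derivatives of elementary differentials -/

open scoped Classical in
/-- Prepends an element to the list at one index of a family of lists. -/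
def prependAt {V E : Type*} (w : V) (x : E) (ρ : V → List E) : V → List E :=
  fun v => if w = v then x :: ρ v else ρ v

theorem prependAt_comp {U V E : Type*} {e : U → V} (he : Function.Injective e) (w : U) (x : E)
    (ρ : V → List E) : (fun u => prependAt (e w) x ρ (e u)) = prependAt w x fun u => ρ (e u) := by
  funext u
  by_cases h : w = u
  · simp [prependAt, h]
  · simp [prependAt, h, he.ne h]

theorem prependAt_comp_of_ne {U V E : Type*} {e : U → V} {w : V} (he : ∀ u, w ≠ e u) (x : E)
    (ρ : V → List E) : (fun u => prependAt w x ρ (e u)) = fun u => ρ (e u) := by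
  funext u
  simp only [prependAt, if_neg (he u)]

mutual
  /-- The elementary differential of a planar tree to which, for every vertex `v`, branches are
  attached whose elementary differentials are the members of the list `ρ v`. -/
  def PTree.vecDiff (f : Fin d → Space m → Space m) (y : Space m) :
      (t : PTree (Fin d)) → (PTree.Vertex t → List (Space m)) → Space m
    | .node a l, ρ => dirDeriv (f a) (PTree.vecDiffList f y l (fun v => ρ (some v)) ++ ρ none) y
  /-- The values of `PTree.vecDiff` for the trees in a list. -/
  def PTree.vecDiffList (f : Fin d → Space m → Space m) (y : Space m) :
      (l : List (PTree (Fin d))) → (PTree.VertexList l → List (Space m)) → List (Space m)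
    | [], _ => []
    | t :: l, ρ => PTree.vecDiff f y t (fun v => ρ (Sum.inl v)) ::
        PTree.vecDiffList f y l (fun v => ρ (Sum.inr v))
end

/-- The two recursions differ only in the order of the branches at each vertex, which symmetry of
the derivatives makes irrelevant. -/
theorem PTree.elemDiff_graft {f : Fin d → Space m → Space m} (hf : ∀ a, ContDiff ℝ ∞ (f a))
    (y : Space m) (t : PTree (Fin d)) (ρ : PTree.Vertex t → List (PTree (Fin d))) :
    PTree.elemDiff f y (PTree.graft t ρ) =
      PTree.vecDiff f y t fun v => (ρ v).map (PTree.elemDiff f y) :=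
  PTree.rec (motive_1 := fun t => ∀ ρ : PTree.Vertex t → List (PTree (Fin d)),
      PTree.elemDiff f y (PTree.graft t ρ) =
        PTree.vecDiff f y t fun v => (ρ v).map (PTree.elemDiff f y))
    (motive_2 := fun l => ∀ ρ : PTree.VertexList l → List (PTree (Fin d)),
      (PTree.graftList l ρ).map (PTree.elemDiff f y) =
        PTree.vecDiffList f y l fun v => (ρ v).map (PTree.elemDiff f y))
    (fun a l ih ρ => by
      rw [PTree.graft, PTree.elemDiff_node hf, List.map_append, ih, PTree.vecDiff,
        dirDeriv_perm (hf a) List.perm_append_comm])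
    (fun ρ => by simp [PTree.graftList, PTree.vecDiffList])
    (fun t l ht hl ρ => by
      rw [PTree.graftList, List.map_cons, ht, hl, PTree.vecDiffList]) t ρ

theorem PTree.vecDiff_nil {f : Fin d → Space m → Space m} (hf : ∀ a, ContDiff ℝ ∞ (f a))
    (y : Space m) (t : PTree (Fin d)) :
    PTree.vecDiff f y t (fun _ => []) = PTree.elemDiff f y t :=
  PTree.rec (motive_1 := fun t => PTree.vecDiff f y t (fun _ => []) = PTree.elemDiff f y t)
    (motive_2 := fun l => PTree.vecDiffList f y l (fun _ => []) = l.map (PTree.elemDiff f y))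
    (fun a l ih => by rw [PTree.vecDiff, ih, PTree.elemDiff_node hf, List.append_nil])
    (by simp [PTree.vecDiffList])
    (fun t l ht hl => by rw [PTree.vecDiffList, ht, hl, List.map_cons]) t

/-- By the Leibniz rule the derivative falls on one vertex at a time, and falling on `w` means
attaching `v` there. The statement for lists carries an arbitrary outer function `g`; its extra
term, in which `g` itself is differentiated, becomes the contribution of the root at the next node.
-/
theorem PTree.contDiff_and_fderiv_vecDiff {f : Fin d → Space m → Space m}
    (hf : ∀ a, ContDiff ℝ ∞ (f a)) (t : PTree (Fin d))
    (ρ : PTree.Vertex t → List (Space m)) :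
    ContDiff ℝ ∞ (fun y => PTree.vecDiff f y t ρ) ∧
      ∀ y v, fderiv ℝ (fun y => PTree.vecDiff f y t ρ) y v =
        ∑ w, PTree.vecDiff f y t (prependAt w v ρ) :=
  PTree.rec (motive_1 := fun t => ∀ ρ : PTree.Vertex t → List (Space m),
      ContDiff ℝ ∞ (fun y => PTree.vecDiff f y t ρ) ∧
        ∀ y v, fderiv ℝ (fun y => PTree.vecDiff f y t ρ) y v =
          ∑ w, PTree.vecDiff f y t (prependAt w v ρ))
    (motive_2 := fun l => ∀ (ρ : PTree.VertexList l → List (Space m)) (g : Space m → Space m),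
      ContDiff ℝ ∞ g → ContDiff ℝ ∞ (fun y => dirDeriv g (PTree.vecDiffList f y l ρ) y) ∧
        ∀ y v, fderiv ℝ (fun y => dirDeriv g (PTree.vecDiffList f y l ρ) y) y v =
          dirDeriv g (v :: PTree.vecDiffList f y l ρ) y +
            ∑ w, dirDeriv g (PTree.vecDiffList f y l (prependAt w v ρ)) y)
    (fun a l ih ρ => by
      -- The constant directions at the root come last in the list, hence are innermost, and are
      -- absorbed into the outer function.
      have h := ih (fun v => ρ (some v)) (dirDeriv (f a) (ρ none)) (contDiff_dirDeriv (hf a) _)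
      simp only [PTree.vecDiff, dirDeriv_append]
      refine ⟨h.1, fun y v => ?_⟩
      rw [h.2]
      refine Eq.trans ?_ (Fintype.sum_option (α := PTree.VertexList l) fun w => dirDeriv
        (dirDeriv (f a) (prependAt w v ρ none))
          (PTree.vecDiffList f y l fun u => prependAt w v ρ (some u)) y).symm
      congr 1
      · have h₁ : (fun u : PTree.VertexList l => prependAt none v ρ (some u)) =
            fun u => ρ (some u) :=
          prependAt_comp_of_ne (e := (some : _ → Option (PTree.VertexList l))) (by simp) v ρ
        have h₂ : prependAt none v ρ none = v :: ρ none := by simp [prependAt]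
        rw [h₁, h₂, ← dirDeriv_append, ← dirDeriv_append]
        exact congrFun (dirDeriv_perm (hf a) List.perm_middle.symm) y
      · refine Finset.sum_congr rfl fun w _ => ?_
        have h₁ : (fun u : PTree.VertexList l => prependAt (some w) v ρ (some u)) =
            prependAt w v fun u => ρ (some u) :=
          prependAt_comp (Option.some_injective (PTree.VertexList l)) w v ρ
        have h₂ : prependAt (some w) v ρ none = ρ none :=
          if_neg (Option.some_ne_none (α := PTree.VertexList l) w)
        rw [h₁, h₂])
    (fun ρ g hg => by
      simp only [PTree.vecDiffList, dirDeriv]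
      refine ⟨hg, fun y v => ?_⟩
      have h : ∑ w : PTree.VertexList (A := Fin d) [], g y = 0 :=
        Fintype.sum_empty (ι := Empty) _
      rw [h, add_zero])
    (fun t l ht hl ρ g hg => by
      have ht' := ht fun v => ρ (Sum.inl v)
      have hl' := hl fun v => ρ (Sum.inr v)
      refine ⟨contDiff_dirDeriv_cons ht'.1 (fun g hg => (hl' g hg).1) hg, fun y v => ?_⟩
      refine (fderiv_dirDeriv_cons ht'.1 (ht'.2 y v) (fun g hg => (hl' g hg).1)
        (fun g hg => (hl' g hg).2 y v) hg).trans (congrArg _ ?_)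
      have hs := Fintype.sum_sum_type (α₁ := PTree.Vertex t) (α₂ := PTree.VertexList l)
        fun w => dirDeriv g (PTree.vecDiffList f y (t :: l) (prependAt w v ρ)) y
      refine Eq.trans ?_ hs.symm
      have h₁ : ∀ w : PTree.Vertex t, PTree.vecDiffList f y (t :: l) (prependAt (.inl w) v ρ) =
          PTree.vecDiff f y t (prependAt w v fun u => ρ (.inl u)) ::
            PTree.vecDiffList f y l fun u => ρ (.inr u) := by
        intro w
        rw [PTree.vecDiffList]
        exact congrArg₂ _ (congrArg _ (prependAt_comp (e := (Sum.inl :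
            PTree.Vertex t → PTree.Vertex t ⊕ PTree.VertexList l)) Sum.inl_injective w v ρ))
          (congrArg _ (prependAt_comp_of_ne (e := (Sum.inr :
            PTree.VertexList l → PTree.Vertex t ⊕ PTree.VertexList l)) (by simp) v ρ))
      have h₂ : ∀ w : PTree.VertexList l,
          PTree.vecDiffList f y (t :: l) (prependAt (.inr w) v ρ) =
          PTree.vecDiff f y t (fun u => ρ (.inl u)) ::
            PTree.vecDiffList f y l (prependAt w v fun u => ρ (.inr u)) := by
        intro w
        rw [PTree.vecDiffList]
        exact congrArg₂ _ (congrArg _ (prependAt_comp_of_ne (e := (Sum.inl :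
            PTree.Vertex t → PTree.Vertex t ⊕ PTree.VertexList l)) (by simp) v ρ))
          (congrArg _ (prependAt_comp (e := (Sum.inr :
            PTree.VertexList l → PTree.Vertex t ⊕ PTree.VertexList l)) Sum.inr_injective w v ρ))
      exact congrArg₂ _ (Finset.sum_congr rfl fun w _ => by rw [h₁])
        (Finset.sum_congr rfl fun w _ => by rw [h₂])) t ρ

theorem PTree.contDiff_elemDiff {f : Fin d → Space m → Space m} (hf : ∀ a, ContDiff ℝ ∞ (f a))
    (t : PTree (Fin d)) : ContDiff ℝ ∞ fun y => PTree.elemDiff f y t := by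
  simpa only [PTree.vecDiff_nil hf] using
    (PTree.contDiff_and_fderiv_vecDiff hf t fun _ => []).1

open scoped Classical in
/-- The lists of the members of `L` that a function on the indices sends to the points of `V`. -/
def fiberLists {V E : Type*} (L : List E) (u : Fin L.length → V) : V → List E :=
  fun w => ((List.finRange L.length).filter fun i => u i = w).map L.get

/-- This matches one further differentiation: the new direction `x` is attached at `w`, and the
earlier assignment `u` is kept. -/
theorem fiberLists_cons {V E : Type*} (x : E) (L : List E) (w : V) (u : Fin L.length → V) :
    fiberLists (x :: L) (Fin.cons w u : Fin (L.length + 1) → V) =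
      prependAt w x (fiberLists L u) := by
  classical
  funext v
  simp only [fiberLists, prependAt, List.length_cons, List.finRange_succ, List.filter_cons,
    List.filter_map]
  split_ifs <;> simp_all [Function.comp_def]

theorem map_prependAt {V E E' : Type*} (θ : E → E') (w : V) (x : E) (ρ : V → List E) :
    (fun v => (prependAt w x ρ v).map θ) = prependAt w (θ x) fun v => (ρ v).map θ := by
  funext v
  by_cases h : w = v <;> simp [prependAt, h]

/-- Each derivative chooses one vertex for its direction, so iterating produces every map from
directions to vertices exactly once; `Fin.consEquiv` adjoins the newest choice. -/
theorem PTree.dirDeriv_elemDiff {f : Fin d → Space m → Space m} (hf : ∀ a, ContDiff ℝ ∞ (f a))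
    (t : PTree (Fin d)) {α : Type*} (θ : α → Space m) (L : List α) :
    dirDeriv (fun y => PTree.elemDiff f y t) (L.map θ) =
      fun y => ∑ u : Fin L.length → PTree.Vertex t,
        PTree.vecDiff f y t fun v => (fiberLists L u v).map θ := by
  induction L with
  | nil =>
    funext y
    refine Eq.trans ?_ (Fintype.sum_unique (ι := Fin 0 → PTree.Vertex t)
      fun u => PTree.vecDiff f y t fun v => (fiberLists [] u v).map θ).symm
    exact (PTree.vecDiff_nil hf y t).symm
  | cons x L ih =>
    funext y
    change fderiv ℝ (dirDeriv _ (L.map θ)) y (θ x) = _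
    rw [ih, fderiv_fun_sum fun u _ =>
      ((PTree.contDiff_and_fderiv_vecDiff hf t _).1.differentiable (by simp) y)]
    rw [sum_apply]
    simp only [(PTree.contDiff_and_fderiv_vecDiff hf t _).2, ← map_prependAt, ← fiberLists_cons]
    rw [Finset.sum_comm, ← Fintype.sum_prod_type']
    exact (Fin.consEquiv fun _ : Fin (L.length + 1) => PTree.Vertex t).sum_comp
      fun u => PTree.vecDiff f y t fun v => (fiberLists (x :: L) u v).map θ

/-- The derivative of an elementary differential in the directions of elementary differentials is
the sum of the elementary differentials over all graftings. -/
theorem PTree.dirDeriv_elemDiff_map_elemDiff {f : Fin d → Space m → Space m}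
    (hf : ∀ a, ContDiff ℝ ∞ (f a)) (y : Space m) (t : PTree (Fin d)) (L : List (PTree (Fin d))) :
    dirDeriv (fun y => PTree.elemDiff f y t) (L.map (PTree.elemDiff f y)) y =
      ∑ u : Fin L.length → PTree.Vertex t,
        PTree.elemDiff f y (PTree.graft t (fiberLists L u)) := by
  simp only [PTree.dirDeriv_elemDiff hf, PTree.elemDiff_graft hf]

/-! ### Sums over forests -/

theorem Forest.multiplicity_eq_prod [DecidableEq (RTree d)] {F : Forest d} {s : Finset (RTree d)}
    (h : F.toFinset ⊆ s) : F.multiplicity = ∏ τ ∈ s, (F.count τ)! := by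
  rw [Forest.multiplicity]
  convert Finset.prod_subset (f := fun τ => (F.count τ)!) h fun τ _ hτ => ?_
  rw [Multiset.count_eq_zero.2 (by simpa using hτ), Nat.factorial_zero]

theorem Forest.multiplicity_zero : (0 : Forest d).multiplicity = 1 := by
  simp [Forest.multiplicity]

theorem Forest.multiplicity_cons [DecidableEq (RTree d)] (τ : RTree d) (F : Forest d) :
    Forest.multiplicity (τ ::ₘ F) = (F.count τ + 1) * F.multiplicity := by
  have h₁ : F.toFinset ⊆ (τ ::ₘ F).toFinset := fun σ h => by simp_all
  rw [Forest.multiplicity_eq_prod subset_rfl, Forest.multiplicity_eq_prod h₁]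
  have hτ : τ ∈ (τ ::ₘ F).toFinset := by simp
  rw [← Finset.mul_prod_erase _ _ hτ, ← Finset.mul_prod_erase _ _ hτ, Multiset.count_cons_self,
    Nat.factorial_succ, mul_assoc]
  congr 2
  refine Finset.prod_congr rfl fun σ hσ => ?_
  rw [Multiset.count_cons_of_ne (Finset.ne_of_mem_erase hσ)]

theorem Forest.multiplicity_pos (F : Forest d) : 0 < F.multiplicity :=
  Finset.prod_pos fun _ _ => Nat.factorial_pos _

/-- Regroups a sum over a tree and a forest by the forest that consists of both. -/
theorem hasSum_card_smul {E : Type*} [NormedAddCommGroup E] [NormedSpace ℝ E]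
    {θ : Forest d → E} {s : E}
    (h : HasSum (fun p : RTree d × Forest d => (p.2.multiplicity : ℝ)⁻¹ • θ (p.1 ::ₘ p.2)) s) :
    HasSum (fun K : Forest d => (Multiset.card K : ℝ) • (K.multiplicity : ℝ)⁻¹ • θ K) s := by
  classical
  rw [← (Equiv.sigmaFiberEquiv fun p : RTree d × Forest d => p.1 ::ₘ p.2).hasSum_iff] at h
  refine h.sigma fun K : Forest d => ?_
  -- A pair in the fibre over `K` is determined by the tree removed from `K`, so the fibre is
  -- indexed by the distinct trees of `K`.
  let e : {τ // τ ∈ K.toFinset} ≃ {p : RTree d × Forest d // p.1 ::ₘ p.2 = K} :=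
    { toFun := fun τ => ⟨(τ.1, K.erase τ.1), Multiset.cons_erase (Multiset.mem_toFinset.1 τ.2)⟩
      invFun := fun p => ⟨p.1.1, Multiset.mem_toFinset.2
        (Multiset.mem_of_le p.2.le (Multiset.mem_cons_self _ _))⟩
      left_inv := fun τ => rfl
      right_inv := by
        rintro ⟨⟨τ, F⟩, rfl⟩
        simp }
  rw [← e.hasSum_iff]
  -- Removing one of `r` copies of `τ` divides the multiplicity by `r`, and these `r` add up to
  -- `card K`.
  have hK : (Multiset.card K : ℝ) • (K.multiplicity : ℝ)⁻¹ • θ K =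
      ∑ τ ∈ K.toFinset, ((Forest.multiplicity (K.erase τ) : ℝ)⁻¹ • θ K) := by
    rw [← Multiset.toFinset_sum_count_eq, Nat.cast_sum, Finset.sum_smul]
    refine Finset.sum_congr rfl fun τ hτ => ?_
    have hm := Forest.multiplicity_cons τ (K.erase τ)
    rw [Multiset.cons_erase (Multiset.mem_toFinset.1 hτ), Multiset.count_erase_self,
      Nat.sub_add_cancel (Multiset.one_le_count_iff_mem.2 (Multiset.mem_toFinset.1 hτ))] at hm
    have h₀ : (K.count τ : ℝ) ≠ 0 := by
      have := Multiset.one_le_count_iff_mem.2 (Multiset.mem_toFinset.1 hτ)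
      positivity
    rw [hm, smul_smul]
    push_cast
    rw [mul_inv, mul_inv_cancel_left₀ h₀]
  rw [hK]
  refine (K.toFinset.hasSum fun τ => ((Forest.multiplicity (K.erase τ) : ℝ)⁻¹ • θ K)).congr_fun
    fun τ => ?_
  exact congrArg (fun L => (Forest.multiplicity (K.erase τ.1) : ℝ)⁻¹ • θ L)
    (Multiset.cons_erase (Multiset.mem_toFinset.1 τ.2))

/-- These are the terms of `(∑ r) ^ n / n!` grouped by forests. The induction multiplies by one more
factor `∑ r` and divides by `n + 1`; the result dominates the family in `hasSum_dirDeriv`. -/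
theorem summable_prod_div_multiplicity {r : RTree d → ℝ} (hr : 0 ≤ r) (hs : Summable r) (n : ℕ) :
    Summable fun F : Forest d =>
      (F.multiplicity : ℝ)⁻¹ * if Multiset.card F = n then (F.map r).prod else 0 := by
  induction n with
  | zero =>
    refine summable_of_ne_finset_zero (s := {0}) fun F hF => ?_
    rw [if_neg (by simpa using hF), mul_zero]
  | succ n ih =>
    have h := hs.mul_of_nonneg ih hr fun F => mul_nonneg (by positivity) (by
      split_ifs
      · exact Multiset.prod_nonneg (by simpa using fun τ _ => hr τ)
      · exact le_rfl)
    have h' := hasSum_card_smul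
      (θ := fun F : Forest d => if Multiset.card F = n + 1 then (F.map r).prod else 0)
      (h.hasSum.congr_fun ?_)
    · refine (h'.summable.mul_left ((n + 1 : ℝ)⁻¹)).congr fun F => ?_
      split_ifs with hF
      · rw [hF]
        simp only [smul_eq_mul]
        push_cast
        field_simp
      · simp
    · intro p
      simp only [Multiset.card_cons, add_left_inj, Multiset.map_cons, Multiset.prod_cons,
        smul_eq_mul]
      split_ifs <;> ring

/-- The multinomial theorem for iterated derivatives. -/
theorem hasSum_dirDeriv {x : RTree d → Space m} (hx : Summable fun τ => ‖x τ‖) (n : ℕ)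
    {g : Space m → Space m} (hg : ContDiff ℝ ∞ g) (y : Space m) :
    HasSum (fun F : Forest d => (F.multiplicity : ℝ)⁻¹ •
        if Multiset.card F = n then dirDeriv g (F.toList.map x) y else 0)
      ((n ! : ℝ)⁻¹ • dirDeriv g (List.replicate n (∑' τ, x τ)) y) := by
  classical
  induction n generalizing g with
  | zero =>
    convert hasSum_ite_eq (0 : Forest d) (g y) using 1
    · funext F
      by_cases hF : F = 0
      · simp [hF, dirDeriv, Forest.multiplicity_zero]
      · simp [hF]
    · simp [dirDeriv]
  | succ n ih =>
    have hp : ∀ (τ : RTree d) (F : Forest d), dirDeriv g ((τ ::ₘ F).toList.map x) =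
        dirDeriv g (x τ :: F.toList.map x) := fun τ F => dirDeriv_perm hg
      ((Multiset.coe_eq_coe.1 (by rw [← Multiset.cons_coe]; simp)).map x : List.Perm _ ((τ :: F.toList).map x))
    have hs : Summable fun p : RTree d × Forest d => (p.2.multiplicity : ℝ)⁻¹ •
        if Multiset.card (p.1 ::ₘ p.2) = n + 1 then
          dirDeriv g ((p.1 ::ₘ p.2).toList.map x) y else 0 := by
      refine Summable.of_norm_bounded (g := fun p : RTree d × Forest d =>
        ‖iteratedFDeriv ℝ (n + 1) g y‖ * (‖x p.1‖ * ((p.2.multiplicity : ℝ)⁻¹ *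
          if Multiset.card p.2 = n then (p.2.map fun τ => ‖x τ‖).prod else 0))) ?_ ?_
      · refine Summable.mul_left _ (hx.mul_of_nonneg
          (summable_prod_div_multiplicity (fun τ => norm_nonneg _) hx n)
          (fun τ => norm_nonneg _) fun F => mul_nonneg (by positivity) ?_)
        split_ifs
        · exact Multiset.prod_nonneg (by simp)
        · exact le_rfl
      · rintro ⟨τ, F⟩
        simp only [Multiset.card_cons, add_left_inj]
        split_ifs with hF
        · rw [hp, norm_smul, norm_inv, RCLike.norm_natCast]
          have h := norm_dirDeriv_le hg (x τ :: F.toList.map x) y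
          have hl : (x τ :: F.toList.map x).length = n + 1 := by simp [hF]
          rw [hl, List.map_cons, List.prod_cons, List.map_map] at h
          have hF' : (F.map fun τ => ‖x τ‖).prod =
              (F.toList.map ((fun v => ‖v‖) ∘ x)).prod := by
            conv_lhs => rw [← Multiset.coe_toList F]
            rfl
          rw [hF']
          refine (mul_le_mul_of_nonneg_left h (by positivity)).trans_eq ?_
          ring
        · simp
    have hsum := hs.hasSum
    -- For fixed `τ`, the sum over forests is the induction hypothesis for the derivative of `g` in
    -- the direction `x τ`; the sum over `τ` then passes through the continuous linear map `fderiv`.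
    have h₁ := hsum.prod_fiberwise (g := fun τ => (n ! : ℝ)⁻¹ •
      fderiv ℝ (dirDeriv g (List.replicate n (∑' τ, x τ))) y (x τ)) fun τ => by
        have h := ih (contDiff_dirDeriv hg [x τ])
        simp only [← dirDeriv_cons' hg, ← hp] at h
        simp only [Multiset.card_cons, add_left_inj]
        exact h
    have h₂ := ((fderiv ℝ (dirDeriv g (List.replicate n (∑' τ, x τ))) y).hasSum
      hx.of_norm.hasSum).const_smul ((n ! : ℝ)⁻¹)
    rw [h₁.unique h₂] at hsum
    -- Regrouping gives a forest of `n + 1` trees the extra weight `n + 1`, which turns `n!` into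
    -- `(n + 1)!`.
    have h₃ := (hasSum_card_smul
      (θ := fun F => if Multiset.card F = n + 1 then dirDeriv g (F.toList.map x) y else 0)
      hsum).const_smul ((n + 1 : ℝ)⁻¹)
    have hv : ((n + 1)! : ℝ)⁻¹ • dirDeriv g (List.replicate (n + 1) (∑' τ, x τ)) y =
        (n + 1 : ℝ)⁻¹ • (n ! : ℝ)⁻¹ •
          fderiv ℝ (dirDeriv g (List.replicate n (∑' τ, x τ))) y (∑' τ, x τ) := by
      rw [smul_smul, Nat.factorial_succ, Nat.cast_mul, Nat.cast_succ, mul_inv]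
      rfl
    rw [hv]
    refine h₃.congr_fun fun F => ?_
    split_ifs with hF
    · rw [hF, smul_smul, Nat.cast_succ, inv_mul_cancel₀ (by positivity), one_smul]
    · simp

theorem dirDeriv_map_smul (g : Space m → Space m) {α : Type*} (a : α → ℝ) (x : α → Space m)
    {L : List α} (hg : ContDiff ℝ ∞ g) (y : Space m) :
    dirDeriv g (L.map fun i => a i • x i) y = (L.map a).prod • dirDeriv g (L.map x) y := by
  induction L generalizing g with
  | nil => simp
  | cons i L ih =>
    rw [List.map_cons, List.map_cons, List.map_cons, List.prod_cons, dirDeriv_cons' hg,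
      ih _ (contDiff_dirDeriv hg _), ← dirDeriv_cons' hg]
    change _ • fderiv ℝ (dirDeriv g (L.map x)) y (a i • x i) =
      _ • fderiv ℝ (dirDeriv g (L.map x)) y (x i)
    rw [map_smul, smul_smul, mul_comm]

/-! ### Taylor expansions -/

theorem iteratedDeriv_comp_line {g : Space m → Space m} (hg : ContDiff ℝ ∞ g) (y h : Space m)
    (n : ℕ) : iteratedDeriv n (fun t : ℝ => g (y + t • h)) =
      fun t => dirDeriv g (List.replicate n h) (y + t • h) := by
  induction n with
  | zero => simp [dirDeriv]
  | succ n ih =>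
    funext t
    rw [iteratedDeriv_succ, ih]
    have h₁ : HasDerivAt (fun t : ℝ => y + t • h) h t := by
      simpa using ((hasDerivAt_id t).smul_const h).const_add y
    exact (((contDiff_dirDeriv hg _).differentiable (by simp) _).hasFDerivAt.comp_hasDerivAt t
      h₁).deriv

/-- One-variable Taylor estimate along `t ↦ y + t • h` on `[0, 1]`. The constant `C` bounds the
derivative of order `N + 1` on the compact unit ball around `y`, uniformly in the direction `h`. -/
theorem isBigO_taylor {g : Space m → Space m} (hg : ContDiff ℝ ∞ g) (y : Space m) (N : ℕ) :
    (fun h => g (y + h) - ∑ n ∈ Finset.range (N + 1),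
      (n ! : ℝ)⁻¹ • dirDeriv g (List.replicate n h) y) =O[𝓝 0] fun h => ‖h‖ ^ (N + 1) := by
  have hc : Continuous (iteratedFDeriv ℝ (N + 1) g) :=
    hg.continuous_iteratedFDeriv (by exact_mod_cast le_top)
  obtain ⟨C, hC⟩ := (isCompact_closedBall y (1 : ℝ)).exists_bound_of_continuousOn hc.continuousOn
  refine Asymptotics.IsBigO.of_bound (C / N !) ?_
  filter_upwards [Metric.closedBall_mem_nhds (0 : Space m) one_pos] with h hh
  have hh' : ‖h‖ ≤ 1 := by simpa using hh
  have hl : ContDiff ℝ ∞ fun t : ℝ => g (y + t • h) := by fun_prop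
  have hw : ∀ (n : ℕ), ∀ t ∈ Set.Icc (0 : ℝ) 1, iteratedDerivWithin n
      (fun t : ℝ => g (y + t • h)) (Set.Icc 0 1) t =
        dirDeriv g (List.replicate n h) (y + t • h) := by
    intro n t ht
    rw [iteratedDerivWithin_eq_iteratedDeriv (uniqueDiffOn_Icc one_pos)
      (hl.contDiffAt.of_le (by exact_mod_cast le_top)) ht, iteratedDeriv_comp_line hg]
  have hT := taylor_mean_remainder_bound (f := fun t : ℝ => g (y + t • h)) (n := N)
    (C := C * ‖h‖ ^ (N + 1)) zero_le_one
    (hl.contDiffOn.of_le (by exact_mod_cast le_top)) (Set.right_mem_Icc.2 zero_le_one) ?_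
  · rw [taylor_within_apply] at hT
    simp only [one_smul, sub_zero, one_pow, mul_one] at hT
    rw [norm_pow, norm_norm]
    refine (le_of_eq ?_).trans (hT.trans_eq (by ring))
    congr 2
    refine Finset.sum_congr rfl fun n _ => ?_
    rw [hw n 0 (Set.left_mem_Icc.2 zero_le_one), zero_smul, add_zero]
  · intro t ht
    rw [hw _ t ht]
    refine (norm_dirDeriv_le hg _ _).trans ?_
    rw [List.length_replicate, List.map_replicate, List.prod_replicate]
    refine mul_le_mul_of_nonneg_right (hC _ ?_) (by positivity)
    rw [mem_closedBall_iff_norm, add_sub_cancel_left, norm_smul, Real.norm_of_nonneg ht.1]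
    exact mul_le_one₀ ht.2 (norm_nonneg _) hh'

/-- If the Taylor series of an analytic function converges absolutely, its sum is the value of the
function. -/
theorem hasSum_taylor_of_summable {g : Space m → Space m} (hg : ContDiff ℝ ∞ g) {y h : Space m}
    {R : ℝ≥0∞} (hR : AnalyticOnNhd ℝ g (Metric.eball y R)) (hh : y + h ∈ Metric.eball y R)
    (hs : Summable fun n : ℕ => ‖(n ! : ℝ)⁻¹ • dirDeriv g (List.replicate n h) y‖) :
    HasSum (fun n : ℕ => (n ! : ℝ)⁻¹ • dirDeriv g (List.replicate n h) y) (g (y + h)) := by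
  set c : ℕ → Space m := fun n => (n ! : ℝ)⁻¹ • dirDeriv g (List.replicate n h) y
  have hmem : ∀ t ∈ Set.Icc (-1 : ℝ) 1, y + t • h ∈ Metric.eball y R := by
    intro t ht
    rw [Metric.mem_eball, edist_eq_enorm_sub, add_sub_cancel_left] at hh ⊢
    refine lt_of_le_of_lt ?_ hh
    rw [enorm_le_iff_norm_le, norm_smul]
    exact mul_le_of_le_one_left (norm_nonneg _) (abs_le.2 ht)
  have hline : AnalyticOnNhd ℝ (fun t : ℝ => g (y + t • h)) (Metric.ball 0 1) := by
    intro t ht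
    have ht' : |t| < 1 := by simpa using ht
    exact (hR _ (hmem t ⟨(abs_lt.1 ht').1.le, (abs_lt.1 ht').2.le⟩)).comp_of_eq
      (f := fun t : ℝ => y + t • h) (by fun_prop) rfl
  -- Analyticity on a ball does not force the Taylor series at the centre to converge on all of it,
  -- so the convergence at `h` is an assumption. It gives the series in `t` a radius of at least
  -- `1`, with `t = 1` possibly on the boundary.
  let q : FormalMultilinearSeries ℝ ℝ (Space m) := fun n =>
    ContinuousMultilinearMap.mkPiRing ℝ (Fin n) (c n)
  have hq : ∀ (n : ℕ) (t : ℝ), q n (fun _ => t) = t ^ n • c n := fun n t => by simp [q]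
  have hr : 1 ≤ q.radius := by
    have := q.le_radius_of_summable (r := 1) (by simpa [q] using hs)
    simpa using this
  have hsub : Metric.ball (0 : ℝ) 1 ⊆ Metric.eball 0 q.radius := by
    rw [← Metric.eball_ofReal]
    exact Metric.eball_subset_eball (by simpa using hr)
  have hqa : AnalyticOnNhd ℝ q.sum (Metric.ball 0 1) :=
    (q.hasFPowerSeriesOnBall (zero_lt_one.trans_le hr)).analyticOnNhd.mono hsub
  have hnear : q.sum =ᶠ[𝓝 0] fun t : ℝ => g (y + t • h) := by
    obtain ⟨p, r, hp⟩ := hR y (Metric.mem_eball_self (pos_of_gt hh))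
    have hcont : Filter.Tendsto (fun t : ℝ => t • h) (𝓝 0) (𝓝 0) := by
      have : Continuous fun t : ℝ => t • h := by fun_prop
      simpa using this.tendsto 0
    filter_upwards [hcont (Metric.eball_mem_nhds 0 hp.r_pos)] with t ht
    have h₁ := hp.hasSum ht
    have h₂ : ∀ n : ℕ, p n (fun _ => t • h) = q n fun _ => t := by
      intro n
      have h₃ := hp.factorial_smul h n
      rw [iteratedFDeriv_eq_dirDeriv hg, List.ofFn_const] at h₃
      rw [hq]
      change _ = t ^ n • (n ! : ℝ)⁻¹ • dirDeriv g (List.replicate n h) y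
      rw [← h₃, ContinuousMultilinearMap.map_smul_univ, Finset.prod_const,
        Finset.card_univ, Fintype.card_fin, ← Nat.cast_smul_eq_nsmul ℝ, smul_smul (_⁻¹),
        inv_mul_cancel₀ (by positivity), one_smul]
    simp only [h₂] at h₁
    exact h₁.tsum_eq
  -- The two functions agree near `0`, hence on the open interval by the identity theorem.
  have heq : Set.EqOn q.sum (fun t : ℝ => g (y + t • h)) (Metric.ball 0 1) :=
    hqa.eqOn_of_preconnected_of_eventuallyEq hline (convex_ball 0 1).isPreconnected
      (Metric.mem_ball_self one_pos) hnear
  -- The endpoint `t = 1` is reached by continuity: the norms `‖c n‖` dominate the series uniformly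
  -- on `[0, 1]`.
  have hcq : ContinuousOn q.sum (Set.Icc 0 1) := by
    have : q.sum = fun t => ∑' n, t ^ n • c n := funext fun t => tsum_congr fun n => hq n t
    rw [this]
    refine continuousOn_tsum (fun n => by fun_prop) hs fun n t ht => ?_
    rw [norm_smul, norm_pow, Real.norm_of_nonneg ht.1]
    exact mul_le_of_le_one_left (norm_nonneg _) (pow_le_one₀ ht.1 ht.2)
  have hcl : ContinuousOn (fun t : ℝ => g (y + t • h)) (Set.Icc 0 1) := by
    have := hg.continuous
    fun_prop
  have h1 : q.sum 1 = g (y + (1 : ℝ) • h) := by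
    refine Set.EqOn.of_subset_closure (s := Set.Ico 0 1) (fun t ht => heq ?_) hcq hcl
      Set.Ico_subset_Icc_self ?_ (Set.right_mem_Icc.2 zero_le_one)
    · rw [mem_ball_zero_iff, Real.norm_of_nonneg ht.1]
      exact ht.2
    · rw [closure_Ico zero_ne_one]
  have h2 : q.sum 1 = ∑' n, c n := tsum_congr fun n => by rw [hq, one_pow, one_smul]
  rw [one_smul, h2] at h1
  rw [← h1]
  exact hs.of_norm.hasSum

/-! ### Symmetry factors and characters -/

theorem Forest.symmFactor_eq (F : Forest d) :
    F.symmFactor = F.multiplicity * (F.map RTree.symmFactor).prod := by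
  classical
  rw [Forest.multiplicity, Forest.symmFactor, Finset.prod_mul_distrib,
    Finset.prod_multiset_map_count]

theorem RTree.symmFactor_pos (τ : RTree d) : 0 < τ.symmFactor := by
  induction τ using Quotient.ind with
  | _ t =>
    induction t using PTree.ind with
    | h a l ih =>
      rw [symmFactor_mk_node, Forest.symmFactor_eq]
      refine Nat.mul_pos (Forest.multiplicity_pos _) (Nat.pos_of_ne_zero ?_)
      refine Multiset.prod_ne_zero fun h => ?_
      obtain ⟨σ, hσ, h₀⟩ := Multiset.mem_map.1 h
      obtain ⟨s, hs, rfl⟩ := List.mem_map.1 (Multiset.mem_coe.1 hσ)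
      exact (ih s hs).ne' h₀

theorem Forest.symmFactor_singleton (τ : RTree d) :
    Forest.symmFactor {τ} = τ.symmFactor := by
  rw [Forest.symmFactor_eq]
  simp [Forest.multiplicity]

theorem Forest.symmFactor_zero : Forest.symmFactor (0 : Forest d) = 1 := by
  simp [Forest.symmFactor]

theorem ofForest_zero : ofForest (0 : Forest d) = 1 := rfl

theorem ofForest_add (F G : Forest d) : ofForest (F + G) = ofForest F * ofForest G := by
  simp [ofForest, AddMonoidAlgebra.single_mul_single]

/-- Both `Z(F)` and `S(F)` factor over the trees of `F`, up to the multiplicity in `S(F)`. What is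
left is exactly the multinomial coefficient of the Taylor expansion; the character property enters
the theorem through this formula. -/
theorem HDual.IsCharacter.apply_div_symmFactor {Z : HDual d} (hZ : Z.IsCharacter)
    (F : Forest d) : Z (ofForest F) / F.symmFactor =
      (F.multiplicity : ℝ)⁻¹ * (F.map fun τ => Z (ofForest {τ}) / τ.symmFactor).prod := by
  have h : Z (ofForest F) = (F.map fun τ => Z (ofForest {τ})).prod := by
    induction F using Multiset.induction with
    | empty => rw [ofForest_zero, hZ.1]; rfl
    | cons τ F ih =>
      rw [← Multiset.singleton_add, ofForest_add, hZ.2, ih, Multiset.map_add,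
        Multiset.prod_add]
      simp
  rw [h, Multiset.prod_map_div, Forest.symmFactor_eq, Nat.cast_mul, Nat.cast_multiset_prod,
    Multiset.map_map]
  simp only [Function.comp_def]
  rw [← div_div, div_eq_inv_mul _ (F.multiplicity : ℝ), mul_div_assoc]

/-! ### The grafting of forests onto trees -/

theorem PTree.length_graftList {A : Type} (l : List (PTree A))
    (ρ : PTree.VertexList l → List (PTree A)) : (PTree.graftList l ρ).length = l.length := by
  induction l with
  | nil => simp [PTree.graftList]
  | cons t l ih => rw [PTree.graftList, List.length_cons, List.length_cons, ih]

theorem simGraft_eq {F G : Forest d} {l : List (PTree (Fin d))} (h : G.reps = l) :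
    simGraft F G = ∑ v : Fin F.reps.length → PTree.VertexList l,
      ofForest (toForest (PTree.graftList l (fiberLists F.reps v))) := by
  subst h
  rfl

/-- Every grafted root is joined to a vertex of `G`, so no component is created or merged. -/
theorem card_of_mem_simGraft {F G K : Forest d} (h : (simGraft F G).coeff K ≠ 0) :
    Multiset.card K = Multiset.card G := by
  classical
  rw [simGraft_eq rfl] at h
  simp only [AddMonoidAlgebra.coeff_sum, Finsupp.coe_finsetSum, Finset.sum_apply] at h
  obtain ⟨v, -, hv⟩ := Finset.exists_ne_zero_of_sum_ne_zero h
  rw [ofForest, AddMonoidAlgebra.coeff_single, Finsupp.single_apply_ne_zero] at hv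
  rw [hv.1, toForest, Multiset.coe_card, List.length_map, PTree.length_graftList, Forest.reps,
    List.length_map, Multiset.length_toList]

theorem fiberLists_comp {U V E : Type*} {e : U → V} (he : Function.Injective e) (L : List E)
    (u : Fin L.length → U) : (fun w => fiberLists L (fun i => e (u i)) (e w)) =
      fiberLists L u := by
  funext w
  exact congrArg _ (List.filter_congr fun i _ => decide_eq_decide.2 he.eq_iff)

theorem simGraft_singleton (F : Forest d) (σ : RTree d) :
    simGraft F {σ} = ∑ u : Fin F.reps.length → PTree.Vertex σ.out,
      ofForest {(Quotient.mk _ (PTree.graft σ.out (fiberLists F.reps u)) : RTree d)} := by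
  rw [simGraft_eq (l := [σ.out]) (by simp [Forest.reps])]
  -- The vertices of a one-tree list form `Vertex σ.out ⊕ Empty`.
  let e : PTree.Vertex σ.out ≃ PTree.VertexList [σ.out] := (Equiv.sumEmpty _ Empty).symm
  rw [← (Equiv.arrowCongr (Equiv.refl (Fin F.reps.length)) e).sum_comp]
  refine Finset.sum_congr rfl fun u _ => ?_
  have h : PTree.graftList [σ.out] (fiberLists F.reps fun i => e (u i)) =
      [PTree.graft σ.out (fiberLists F.reps u)] := by
    rw [PTree.graftList, PTree.graftList]
    exact congrArg (fun ρ => [PTree.graft σ.out ρ]) (fiberLists_comp e.injective F.reps u)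
  exact congrArg (fun l => ofForest (toForest l)) h

open scoped Classical in
theorem coeff_simGraft_singleton (F : Forest d) (σ τ : RTree d) :
    (simGraft F {σ}).coeff {τ} = ∑ u : Fin F.reps.length → PTree.Vertex σ.out,
      if τ = Quotient.mk _ (PTree.graft σ.out (fiberLists F.reps u)) then (1 : ℝ) else 0 := by
  rw [simGraft_singleton, AddMonoidAlgebra.coeff_sum, Finsupp.coe_finsetSum, Finset.sum_apply]
  refine Finset.sum_congr rfl fun u _ => ?_
  rw [ofForest, AddMonoidAlgebra.coeff_single, Finsupp.single_apply]
  simp only [Multiset.singleton_inj, eq_comm]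

/-- The coefficient counts graftings. Its sign lets the product of `Z₁.abs` and `Z₂.abs` control the
norms of all the terms for `Z₁` and `Z₂`. -/
theorem coeff_simGraft_singleton_nonneg (F : Forest d) (σ τ : RTree d) :
    0 ≤ (simGraft F {σ}).coeff {τ} := by
  classical
  rw [coeff_simGraft_singleton]
  exact Finset.sum_nonneg fun u _ => by split_ifs <;> simp

theorem hasSum_coeff_simGraft_smul {E : Type*} [NormedAddCommGroup E] [NormedSpace ℝ E]
    (F : Forest d) (σ : RTree d) (x : RTree d → E) :
    HasSum (fun τ => (simGraft F {σ}).coeff {τ} • x τ)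
      (∑ u : Fin F.reps.length → PTree.Vertex σ.out,
        x (Quotient.mk _ (PTree.graft σ.out (fiberLists F.reps u)))) := by
  classical
  simp only [coeff_simGraft_singleton, Finset.sum_smul]
  refine hasSum_sum fun u _ => ?_
  refine (hasSum_ite_eq (Quotient.mk _ (PTree.graft σ.out (fiberLists F.reps u)) : RTree d)
    (x (Quotient.mk _ (PTree.graft σ.out (fiberLists F.reps u))))).congr_fun fun τ => ?_
  split_ifs with h
  · rw [h, one_smul]
  · rw [zero_smul]

/-- The Leibniz formula for graftings, with the graftings collected according to the resulting tree.
-/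
theorem hasSum_coeff_simGraft_smul_elemDiff {f : Fin d → Space m → Space m}
    (hf : ∀ a, ContDiff ℝ ∞ (f a)) (y : Space m) (F : Forest d) (σ : RTree d) :
    HasSum (fun τ => (simGraft F {σ}).coeff {τ} • elemDiff f τ y)
      (dirDeriv (elemDiff f σ) (F.toList.map fun τ => elemDiff f τ y) y) := by
  have h := hasSum_coeff_simGraft_smul F σ fun τ => elemDiff f τ y
  simp only [elemDiff_mk hf, ← PTree.dirDeriv_elemDiff_map_elemDiff hf] at h
  rw [Forest.reps, List.map_map] at h
  exact h

/-! ### The coefficients of the product on trees -/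

/-- In the induction the new tree goes to one of the two parts, and the splittings that put it in
the first part vanish by hypothesis. -/
theorem sum_map_antidiagonal_of_fst {E : Type*} [AddCommMonoid E] (F : Forest d)
    (θ : Forest d × Forest d → E) (h : ∀ p ∈ F.antidiagonal, p.1 ≠ 0 → θ p = 0) :
    (F.antidiagonal.map θ).sum = θ (0, F) := by
  induction F using Multiset.induction generalizing θ with
  | empty => simp
  | cons τ F ih =>
    rw [Multiset.antidiagonal_cons, Multiset.map_add, Multiset.sum_add, Multiset.map_map,
      Multiset.map_map, ih, Multiset.sum_eq_zero, add_zero]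
    · rfl
    · intro z hz
      obtain ⟨p, hp, rfl⟩ := Multiset.mem_map.1 hz
      refine h _ ?_ (Multiset.cons_ne_zero)
      rw [Multiset.antidiagonal_cons]
      exact Multiset.mem_add.2 (Or.inr (Multiset.mem_map_of_mem _ hp))
    · intro p hp hp'
      refine h _ ?_ hp'
      rw [Multiset.antidiagonal_cons]
      exact Multiset.mem_add.2 (Or.inl (Multiset.mem_map_of_mem _ hp))

theorem coeff_starForest (F G K : Forest d) : (starForest F G).coeff K =
    (F.antidiagonal.map fun p => (ofForest p.1 * simGraft p.2 G).coeff K).sum := by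
  rw [starForest]
  have h : ∀ s : Multiset (HBCK d), s.sum.coeff K = (s.map fun x => x.coeff K).sum := by
    intro s
    induction s using Multiset.induction with
    | empty => simp
    | cons x s ih => simp [ih]
  rw [h, Multiset.map_map]
  rfl

theorem exists_of_coeff_ofForest_mul_simGraft_ne_zero {F₁ F₂ G K : Forest d}
    (h : (ofForest F₁ * simGraft F₂ G).coeff K ≠ 0) :
    ∃ K', F₁ + K' = K ∧ (simGraft F₂ G).coeff K' ≠ 0 := by
  by_cases hd : ∃ K', F₁ + K' = K
  · obtain ⟨K', rfl⟩ := hd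
    exact ⟨K', rfl, by simpa [ofForest] using h⟩
  · push Not at hd
    exact absurd (AddMonoidAlgebra.coeff_single_mul_of_forall_add_ne _ _ hd) h

/-- Grafting onto `σ` already yields one component, so a nonempty ungrafted part would leave at
least two trees. -/
theorem coeff_starForest_singleton (F : Forest d) (σ τ : RTree d) :
    (starForest F {σ}).coeff {τ} = (simGraft F {σ}).coeff {τ} := by
  rw [coeff_starForest, sum_map_antidiagonal_of_fst, ofForest_zero, one_mul]
  rintro ⟨F₁, F₂⟩ - h₀
  by_contra h
  obtain ⟨K', hK, hK'⟩ := exists_of_coeff_ofForest_mul_simGraft_ne_zero h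
  have h₁ := congrArg Multiset.card hK
  rw [Multiset.card_add, card_of_mem_simGraft hK'] at h₁
  simp only [Multiset.card_singleton, Nat.add_eq_right, Multiset.card_eq_zero] at h₁
  exact h₀ h₁

theorem simGraft_zero_zero : simGraft (0 : Forest d) 0 = 1 := by
  have h := simGraft_eq (F := (0 : Forest d)) (G := 0) (l := []) (by simp [Forest.reps])
  rw [h, ← ofForest_zero]
  have : IsEmpty (Fin (Forest.reps (0 : Forest d)).length) := by
    simp only [Forest.reps, Multiset.toList_zero, List.map_nil, List.length_nil]
    infer_instance
  rw [Fintype.sum_unique]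
  simp [PTree.graftList, toForest]

theorem Forest.eq_zero_of_size_eq_zero {F : Forest d} (h : F.size = 0) : F = 0 := by
  by_contra hF
  obtain ⟨τ, hτ⟩ := Multiset.exists_mem_of_ne_zero hF
  rw [Forest.size, Multiset.sum_eq_zero_iff] at h
  have hs := h _ (Multiset.mem_map_of_mem _ hτ)
  induction τ using Quotient.ind with
  | _ t =>
    cases t with
    | node a l => exact Nat.succ_ne_zero _ hs

-- The empty forest has no vertex to graft onto, so every tree of `F` stays ungrafted. The
-- antidiagonal is swapped because here the grafted part is the one that must be empty.
open scoped Classical in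
theorem coeff_starForest_zero (F K : Forest d) :
    (starForest F 0).coeff K = if F = K then 1 else 0 := by
  rw [coeff_starForest, ← Multiset.map_swap_antidiagonal, Multiset.map_map,
    sum_map_antidiagonal_of_fst]
  · simp only [Function.comp_def, Prod.swap, simGraft_zero_zero, mul_one]
    rw [ofForest, AddMonoidAlgebra.coeff_single, Finsupp.single_apply]
  · rintro ⟨F₁, F₂⟩ - h₀
    by_contra h
    obtain ⟨K', -, hK'⟩ := exists_of_coeff_ofForest_mul_simGraft_ne_zero h
    have h₁ := size_of_mem_simGraft hK'
    have h₂ := card_of_mem_simGraft hK'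
    rw [Multiset.card_zero, Multiset.card_eq_zero] at h₂
    subst h₂
    simp only [Prod.swap, Forest.size, Multiset.map_zero, Multiset.sum_zero, add_zero] at h₁
    exact h₀ (Forest.eq_zero_of_size_eq_zero h₁.symm)

/-- A forest in the product has at least as many components as `G`. -/
theorem card_le_one_of_coeff_starForest_ne_zero {F G : Forest d} {τ : RTree d}
    (h : (starForest F G).coeff {τ} ≠ 0) : Multiset.card G ≤ 1 := by
  rw [coeff_starForest] at h
  by_contra hG
  refine h (Multiset.sum_eq_zero fun z hz => ?_)
  obtain ⟨p, -, rfl⟩ := Multiset.mem_map.1 hz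
  by_contra hp
  obtain ⟨K', hK, hK'⟩ := exists_of_coeff_ofForest_mul_simGraft_ne_zero hp
  have h₁ := congrArg Multiset.card hK
  rw [Multiset.card_add, card_of_mem_simGraft hK', Multiset.card_singleton] at h₁
  omega

/-- The coefficients of `Z₁ ⋆ Z₂` at trees. -/
theorem hasSum_star (Z₁ Z₂ : HDual d) (τ : RTree d) :
    HasSum (fun p : Forest d × RTree d => (Z₁ (ofForest p.1) / p.1.symmFactor) *
        (Z₂ (ofForest {p.2}) / p.2.symmFactor) * (simGraft p.1 {p.2}).coeff {τ})
      (star Z₁ Z₂ (ofForest {τ}) / τ.symmFactor -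
        Z₁ (ofForest {τ}) / τ.symmFactor * Z₂ 1) := by
  classical
  have hτ : (τ.symmFactor : ℝ) ≠ 0 := by exact_mod_cast τ.symmFactor_pos.ne'
  set T : Forest d × Forest d → ℝ := fun p => (Z₁ (ofForest p.1) / p.1.symmFactor) *
    (Z₂ (ofForest p.2) / p.2.symmFactor) * pairing (starForest p.1 p.2) (ofForest {τ}) with hT
  have hTp : ∀ F G, T (F, G) = (Z₁ (ofForest F) / F.symmFactor) *
      (Z₂ (ofForest G) / G.symmFactor) *
        ((starForest F G).coeff {τ} * τ.symmFactor) := fun F G => by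
    simp only [hT, pairing, HDual.ofValues_ofForest, Forest.symmFactor_singleton]
  have h₁ : HasSum T (star Z₁ Z₂ (ofForest {τ})) := by
    have hfin := finite_support_star Z₁ Z₂ {τ}
    have h := (summable_of_hasFiniteSupport hfin : Summable T).hasSum
    rw [tsum_eq_finsum hfin] at h
    rw [star, HDual.ofValues_ofForest]
    exact h
  -- The pair `({τ}, 0)` is the only contributing one whose second entry is not a single tree. Once
  -- it is subtracted, the sum is supported on the pairs `(F, {σ})`.
  have h₂ := (h₁.sub (hasSum_ite_eq (({τ}, 0) : Forest d × Forest d)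
    (Z₁ (ofForest {τ}) * Z₂ 1))).div_const (τ.symmFactor : ℝ)
  have hinj : Function.Injective fun p : Forest d × RTree d => (p.1, ({p.2} : Forest d)) := by
    rintro ⟨F, σ⟩ ⟨F', σ'⟩ h
    simpa using h
  rw [sub_div, mul_div_right_comm] at h₂
  rw [← hinj.hasSum_iff] at h₂
  · refine h₂.congr_fun ?_
    rintro ⟨F, σ⟩
    have hne : ¬ ((F, ({σ} : Forest d)) = ({τ}, 0)) := by simp
    simp only [Function.comp_apply, if_neg hne, sub_zero, hTp, coeff_starForest_singleton,
      Forest.symmFactor_singleton]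
    field_simp
  · rintro ⟨F, G⟩ hG
    have hG' : ∀ σ, G ≠ {σ} := fun σ hσ => hG ⟨(F, σ), by simp [hσ]⟩
    by_cases h₀ : G = 0
    · subst h₀
      rw [hTp, coeff_starForest_zero, Forest.symmFactor_zero, ofForest_zero]
      by_cases hF : F = {τ}
      · subst hF
        rw [if_pos rfl, if_pos rfl, Forest.symmFactor_singleton]
        field_simp
        simp
      · simp [hF]
    · have hc : (starForest F G).coeff {τ} = 0 := by
        by_contra hc
        have hle := card_le_one_of_coeff_starForest_ne_zero hc
        have hpos := Multiset.card_pos.2 h₀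
        obtain ⟨σ, hσ⟩ := Multiset.card_eq_one.1 (le_antisymm hle hpos)
        exact hG' σ hσ
      rw [hTp, hc]
      simp [h₀]

/-! ### Composition of B-series -/

variable {f : Fin d → Space m → Space m}

theorem contDiff_elemDiff (hf : ∀ a, ContDiff ℝ ∞ (f a)) (τ : RTree d) :
    ContDiff ℝ ∞ (elemDiff f τ) :=
  PTree.contDiff_elemDiff hf τ.out

theorem analyticOnNhd_elemDiff (hf : ∀ a, ContDiff ℝ ∞ (f a)) {s : Set (Space m)}
    (hs : ∀ a, AnalyticOnNhd ℝ (f a) s) (τ : RTree d) : AnalyticOnNhd ℝ (elemDiff f τ) s :=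
  PTree.analyticOnNhd_elemDiff hf hs τ.out

theorem hasSum_bTerm_star (f : Fin d → Space m → Space m) (y : Space m) (Z₁ Z₂ : HDual d)
    (τ : RTree d) :
    HasSum (fun p : Forest d × RTree d => ((Z₁ (ofForest p.1) / p.1.symmFactor) *
        (Z₂ (ofForest {p.2}) / p.2.symmFactor)) • (simGraft p.1 {p.2}).coeff {τ} • elemDiff f τ y)
      (bTerm f y (star Z₁ Z₂) τ - Z₂ 1 • bTerm f y Z₁ τ) := by
  have h := (hasSum_star Z₁ Z₂ τ).smul_const (elemDiff f τ y)
  rw [sub_smul, mul_comm _ (Z₂ 1), ← smul_smul] at h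
  exact h.congr_fun fun p => by rw [smul_smul]

/-- The Taylor expansion of an analytic function at `y`, evaluated at a B-series, as a sum over
forests. -/
theorem hasSum_forest_of_summable {y : Space m} {Z : HDual d} (hZ : Z.IsCharacter)
    (hy : BSeriesConverges f y Z) {g : Space m → Space m} (hg : ContDiff ℝ ∞ g) {R : ℝ≥0∞}
    (hR : AnalyticOnNhd ℝ g (Metric.eball y R)) (hB : bSeries f y Z ∈ Metric.eball y R)
    (hs : Summable fun F : Forest d => (Z (ofForest F) / F.symmFactor) •
      dirDeriv g (F.toList.map fun τ => elemDiff f τ y) y) :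
    HasSum (fun F : Forest d => (Z (ofForest F) / F.symmFactor) •
      dirDeriv g (F.toList.map fun τ => elemDiff f τ y) y) (g (bSeries f y Z)) := by
  have hw : ∀ F : Forest d, (Z (ofForest F) / F.symmFactor) •
      dirDeriv g (F.toList.map fun τ => elemDiff f τ y) y =
      (F.multiplicity : ℝ)⁻¹ • dirDeriv g (F.toList.map (bTerm f y Z)) y := by
    intro F
    have h := dirDeriv_map_smul g (fun τ => Z (ofForest {τ}) / τ.symmFactor)
      (fun τ => elemDiff f τ y) (L := F.toList) hg y
    change dirDeriv g (F.toList.map (bTerm f y Z)) y = _ at h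
    rw [h, hZ.apply_div_symmFactor, smul_smul]
    conv_lhs => rw [← Multiset.coe_toList F, Multiset.map_coe, Multiset.prod_coe,
      Multiset.coe_toList]
  simp only [hw] at hs ⊢
  have hsum := hs.hasSum
  have h := hsum
  -- Grouped by the number of trees, the forest sum becomes the Taylor series, which inherits the
  -- absolute convergence needed in `hasSum_taylor_of_summable`.
  rw [← (Equiv.sigmaFiberEquiv fun F : Forest d => Multiset.card F).hasSum_iff] at h
  have h' := h.sigma (g := fun n => (n ! : ℝ)⁻¹ •
    dirDeriv g (List.replicate n (∑' τ, bTerm f y Z τ)) y) fun n => by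
      refine (hasSum_subtype_iff_indicator (f := fun F : Forest d =>
        (F.multiplicity : ℝ)⁻¹ • dirDeriv g (F.toList.map (bTerm f y Z)) y) (s := {F : Forest d | Multiset.card F = n})).2 ?_
      refine (hasSum_dirDeriv hy n hg y).congr_fun fun F => ?_
      by_cases hF : Multiset.card F = n <;> simp [Set.indicator, hF]
  have hT := hasSum_taylor_of_summable hg hR hB h'.summable.norm
  rw [bSeries, ← h'.unique hT]
  exact hsum

theorem dilate_apply (ε : ℝ) (Z : HDual d) (F : Forest d) :
    Z.dilate ε (ofForest F) = ε ^ F.size * Z (ofForest F) := HDual.ofValues_ofForest _ _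

theorem abs_apply (Z : HDual d) (F : Forest d) :
    Z.abs (ofForest F) = |Z (ofForest F)| := HDual.ofValues_ofForest _ _

/-- Fubini for the family `T` over triples `(τ, F, σ)`: fixing `τ` yields the terms of the product,
while summing over `τ`, then `F`, yields the terms of the outer series. -/
theorem bSeries_comp (hf : ∀ a, ContDiff ℝ ∞ (f a)) (y : Space m) {Z₁ Z₂ : HDual d}
    (hZ₁ : Z₁.IsCharacter) (hZ₂ : Z₂ 1 = 1) {R : ℝ≥0∞}
    (hR : ∀ a, AnalyticOnNhd ℝ (f a) (Metric.eball y R))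
    (hs : BSeriesConverges f y (star Z₁.abs Z₂.abs)) (hB : bSeries f y Z₁ ∈ Metric.eball y R) :
    BSeriesConverges f y Z₁ ∧ BSeriesConverges f (bSeries f y Z₁) Z₂ ∧
      BSeriesConverges f y (star Z₁ Z₂) ∧
      bSeries f (bSeries f y Z₁) Z₂ = bSeries f y (star Z₁ Z₂) := by
  have hZ₂' : Z₂.abs 1 = 1 := by rw [← ofForest_zero, abs_apply, ofForest_zero, hZ₂, abs_one]
  set T : RTree d × (Forest d × RTree d) → Space m := fun q =>
    ((Z₁ (ofForest q.2.1) / q.2.1.symmFactor) * (Z₂ (ofForest {q.2.2}) / q.2.2.symmFactor)) •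
      (simGraft q.2.1 {q.2.2}).coeff {q.1} • elemDiff f q.1 y with hT
  have hnorm : ∀ q, ‖T q‖ = (Z₁.abs (ofForest q.2.1) / q.2.1.symmFactor) *
      (Z₂.abs (ofForest {q.2.2}) / q.2.2.symmFactor) *
        (simGraft q.2.1 {q.2.2}).coeff {q.1} * ‖elemDiff f q.1 y‖ := by
    intro q
    rw [norm_smul, norm_smul, Real.norm_of_nonneg (coeff_simGraft_singleton_nonneg _ _ _), norm_mul,
      norm_div, norm_div, abs_apply, abs_apply]
    simp [mul_assoc]
  have hstar : ∀ τ, HasSum (fun p => ‖T (τ, p)‖)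
      (star Z₁.abs Z₂.abs (ofForest {τ}) / τ.symmFactor * ‖elemDiff f τ y‖ -
        ‖bTerm f y Z₁ τ‖) := by
    intro τ
    have h := (hasSum_star Z₁.abs Z₂.abs τ).mul_right ‖elemDiff f τ y‖
    rw [hZ₂', mul_one, sub_mul] at h
    have hb : ‖bTerm f y Z₁ τ‖ =
        Z₁.abs (ofForest {τ}) / τ.symmFactor * ‖elemDiff f τ y‖ := by
      rw [bTerm, norm_smul, norm_div, abs_apply]
      simp
    rw [hb]
    exact h.congr_fun fun p => hnorm _
  -- The difference of the two sides is a sum of norms. This is how convergence of the inner series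
  -- follows from the assumption on the product.
  have hle : ∀ τ, ‖bTerm f y Z₁ τ‖ ≤
      star Z₁.abs Z₂.abs (ofForest {τ}) / τ.symmFactor * ‖elemDiff f τ y‖ := fun τ =>
    sub_nonneg.1 ((hstar τ).nonneg fun p => norm_nonneg _)
  have hs' : Summable fun τ =>
      star Z₁.abs Z₂.abs (ofForest {τ}) / τ.symmFactor * ‖elemDiff f τ y‖ := by
    refine hs.congr fun τ => ?_
    have h₀ := (norm_nonneg _).trans (hle τ)
    rw [bTerm, norm_smul, Real.norm_eq_abs, ← abs_of_nonneg h₀, abs_mul, abs_norm]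
  have hc₁ : BSeriesConverges f y Z₁ := Summable.of_nonneg_of_le (fun _ => norm_nonneg _) hle hs'
  have hTs : Summable T := by
    refine Summable.of_norm ((summable_prod_of_nonneg fun q => norm_nonneg _).2
      ⟨fun τ => (hstar τ).summable, ?_⟩)
    simp only [(hstar _).tsum_eq]
    exact hs'.sub hc₁
  have h₁ := hTs.hasSum.prod_fiberwise fun τ => hasSum_bTerm_star f y Z₁ Z₂ τ
  rw [hZ₂] at h₁
  simp only [one_smul] at h₁
  have h₂ : HasSum (bTerm f y (star Z₁ Z₂)) (∑' q, T q + ∑' τ, bTerm f y Z₁ τ) :=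
    (h₁.add hc₁.of_norm.hasSum).congr_fun fun τ => (sub_add_cancel _ _).symm
  have h₃ := (((Equiv.prodComm _ _).hasSum_iff (f := T)).2 hTs.hasSum).prod_fiberwise fun p =>
    (hasSum_coeff_simGraft_smul_elemDiff hf y p.1 p.2).const_smul
      ((Z₁ (ofForest p.1) / p.1.symmFactor) * (Z₂ (ofForest {p.2}) / p.2.symmFactor))
  have h₄ := ((Equiv.prodComm _ _).hasSum_iff).2 h₃
  have h₅ := h₄.prod_fiberwise (g := bTerm f (bSeries f y Z₁) Z₂) fun σ => by
    -- Summability over forests for fixed `σ` comes from dividing by this coefficient. If the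
    -- coefficient is zero, all the terms concerned vanish.
    by_cases hσ : Z₂ (ofForest {σ}) / σ.symmFactor = 0
    · rw [bTerm, hσ, zero_smul]
      refine hasSum_zero.congr_fun fun F => ?_
      simp [hσ]
    · have hsF := h₄.summable.prod_factor σ
      have hrw : ∀ F : Forest d, ((Z₁ (ofForest F) / F.symmFactor) *
          (Z₂ (ofForest {σ}) / σ.symmFactor)) •
            dirDeriv (elemDiff f σ) (F.toList.map fun τ => elemDiff f τ y) y =
          (Z₂ (ofForest {σ}) / σ.symmFactor) • (Z₁ (ofForest F) / F.symmFactor) •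
            dirDeriv (elemDiff f σ) (F.toList.map fun τ => elemDiff f τ y) y := fun F => by
        rw [smul_smul, mul_comm]
      have hsF' : Summable fun F : Forest d => (Z₁ (ofForest F) / F.symmFactor) •
          dirDeriv (elemDiff f σ) (F.toList.map fun τ => elemDiff f τ y) y :=
        (hsF.const_smul (Z₂ (ofForest {σ}) / (σ.symmFactor : ℝ))⁻¹).congr fun F =>
          (congrArg (_⁻¹ • ·) (hrw F)).trans (inv_smul_smul₀ hσ _)
      exact ((hasSum_forest_of_summable hZ₁ hc₁ (contDiff_elemDiff hf σ)
        (analyticOnNhd_elemDiff hf hR σ) hB hsF').const_smul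
          (Z₂ (ofForest {σ}) / (σ.symmFactor : ℝ))).congr_fun fun F => hrw F
  refine ⟨hc₁, h₅.summable.norm, h₂.summable.norm, ?_⟩
  rw [bSeries, h₅.tsum_eq, bSeries, bSeries, h₂.tsum_eq]
  abel

/-! ### Truncated B-series -/

theorem RTree.size_pos (τ : RTree d) : 0 < τ.size := by
  induction τ using Quotient.ind with
  | _ t =>
    cases t with
    | node a l => exact Nat.succ_pos _

theorem Forest.card_le_size (F : Forest d) : Multiset.card F ≤ F.size := by
  induction F using Multiset.induction with
  | empty => simp
  | cons τ F ih =>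
    have h := τ.size_pos
    simp only [Forest.size, Multiset.map_cons, Multiset.sum_cons, Multiset.card_cons] at ih ⊢
    omega

theorem Forest.size_le_of_mem {τ : RTree d} {F : Forest d} (h : τ ∈ F) : τ.size ≤ F.size :=
  Multiset.single_le_sum (by simp) _ (Multiset.mem_map_of_mem _ h)

theorem Forest.prod_map_pow_size_mul (a : RTree d → ℝ) (ε : ℝ) (F : Forest d) :
    (F.map fun τ => ε ^ τ.size * a τ).prod = ε ^ F.size * (F.map a).prod := by
  induction F using Multiset.induction with
  | empty => simp [Forest.size]
  | cons τ F ih =>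
    simp only [Forest.size, Multiset.map_cons, Multiset.sum_cons, Multiset.prod_cons] at ih ⊢
    rw [ih]
    ring

theorem isBigO_pow_smul {E : Type*} [NormedAddCommGroup E] [NormedSpace ℝ E] {n k : ℕ}
    (h : n ≤ k) (c : E) : (fun ε : ℝ => ε ^ k • c) =O[𝓝 0] fun ε : ℝ => ε ^ n := by
  refine Asymptotics.IsBigO.of_bound ‖c‖ ?_
  filter_upwards [Metric.closedBall_mem_nhds (0 : ℝ) one_pos] with ε hε
  rw [norm_smul, mul_comm, norm_pow, norm_pow]
  exact mul_le_mul_of_nonneg_left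
    (pow_le_pow_of_le_one (norm_nonneg _) (by simpa using hε) h) (norm_nonneg _)

/-- The Taylor expansion along a polynomial curve, as a sum over forests graded by the number of
vertices. -/
theorem isBigO_sum_forest {g : Space m → Space m} (hg : ContDiff ℝ ∞ g) (y : Space m)
    (S : Finset (RTree d)) (a : RTree d → ℝ) (ha : ∀ τ ∉ S, a τ = 0) (v : RTree d → Space m)
    (M : ℕ) :
    (fun ε : ℝ => g (y + ∑ τ ∈ S, (ε ^ τ.size * a τ) • v τ) -
      ∑ F ∈ (finite_forest_size_le d M).toFinset, ε ^ F.size •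
        ((F.multiplicity : ℝ)⁻¹ * (F.map a).prod) • dirDeriv g (F.toList.map v) y)
      =O[𝓝 0] fun ε : ℝ => ε ^ (M + 1) := by
  classical
  -- The Taylor polynomial truncates by the number of trees, whereas the claim truncates by the
  -- number of vertices; `u` belongs to the first truncation.
  set u : Forest d → Space m := fun F => if Multiset.card F ≤ M then
    ((F.multiplicity : ℝ)⁻¹ * (F.map a).prod) • dirDeriv g (F.toList.map v) y else 0 with hu
  have hfin : (Function.support u).Finite := by
    -- A forest in the support consists of trees of `S`, each occurring at most `M` times.
    refine (Set.finite_Iic (M • S.val)).subset fun F hF => ?_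
    have hcard : Multiset.card F ≤ M := by
      by_contra h
      exact hF (if_neg h)
    have hS : ∀ τ ∈ F, τ ∈ S := by
      intro τ hτ
      by_contra h
      refine hF ?_
      have h₀ : (F.map a).prod = 0 :=
        Multiset.prod_eq_zero (Multiset.mem_map.2 ⟨τ, hτ, ha τ h⟩)
      simp [hu, h₀]
    refine Multiset.le_iff_count.2 fun τ => ?_
    by_cases hτ : τ ∈ F
    · rw [Multiset.count_nsmul, Multiset.count_eq_one_of_mem S.nodup (hS τ hτ), mul_one]
      exact (Multiset.count_le_card τ F).trans hcard
    · rw [Multiset.count_eq_zero.2 hτ]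
      exact Nat.zero_le _
  have hcurve : (fun ε : ℝ => ∑ τ ∈ S, (ε ^ τ.size * a τ) • v τ) =O[𝓝 0] fun ε : ℝ => ε := by
    refine Asymptotics.IsBigO.fun_sum fun τ _ => ?_
    simpa only [pow_one, smul_smul] using isBigO_pow_smul τ.size_pos (a τ • v τ)
  have hcurve' : Filter.Tendsto (fun ε : ℝ => ∑ τ ∈ S, (ε ^ τ.size * a τ) • v τ) (𝓝 0) (𝓝 0) :=
    hcurve.trans_tendsto Filter.tendsto_id
  have hTaylor := (isBigO_taylor hg y M).comp_tendsto hcurve'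
  have hO := hTaylor.trans (hcurve.norm_left.pow (M + 1))
  have hpoly : ∀ ε : ℝ, ∑ n ∈ Finset.range (M + 1), (n ! : ℝ)⁻¹ • dirDeriv g
      (List.replicate n (∑ τ ∈ S, (ε ^ τ.size * a τ) • v τ)) y =
      ∑ F ∈ hfin.toFinset, ε ^ F.size • u F := by
    intro ε
    have hsupp : ∀ τ ∉ S, (ε ^ τ.size * a τ) • v τ = 0 := fun τ hτ => by simp [ha τ hτ]
    have hx : Summable fun τ => ‖(ε ^ τ.size * a τ) • v τ‖ :=
      summable_of_ne_finset_zero (s := S) fun τ hτ => by rw [hsupp τ hτ, norm_zero]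
    have h := hasSum_sum (s := Finset.range (M + 1)) fun n _ => hasSum_dirDeriv hx n hg y
    rw [tsum_eq_sum hsupp] at h
    refine h.unique ((hasSum_sum_of_ne_finset_zero (f := fun F : Forest d => ε ^ F.size • u F)
      (s := hfin.toFinset) fun F hF => ?_).congr_fun fun F => ?_)
    · rw [(by simpa using hF : u F = 0), smul_zero]
    · simp only [smul_ite, smul_zero, Finset.sum_ite_eq, Finset.mem_range, Nat.lt_succ_iff, hu]
      split_ifs
      · rw [dirDeriv_map_smul g _ _ hg]
        have hprod := Forest.prod_map_pow_size_mul a ε F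
        conv_lhs at hprod => rw [← Multiset.coe_toList F, Multiset.map_coe, Multiset.prod_coe]
        rw [hprod, smul_smul, smul_smul, mul_left_comm]
      · rfl
  -- A forest has at most as many trees as vertices, so the Taylor polynomial contains all forests
  -- with at most `M` vertices; the surplus forests have at least `M + 1`.
  have hrest : (fun ε : ℝ => ∑ F ∈ hfin.toFinset, ε ^ F.size • u F -
      ∑ F ∈ (finite_forest_size_le d M).toFinset, ε ^ F.size •
        ((F.multiplicity : ℝ)⁻¹ * (F.map a).prod) • dirDeriv g (F.toList.map v) y)
      =O[𝓝 0] fun ε : ℝ => ε ^ (M + 1) := by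
    have hrw : ∀ ε : ℝ, ∑ F ∈ hfin.toFinset, ε ^ F.size • u F -
        ∑ F ∈ (finite_forest_size_le d M).toFinset, ε ^ F.size •
          ((F.multiplicity : ℝ)⁻¹ * (F.map a).prod) • dirDeriv g (F.toList.map v) y =
        ∑ F ∈ hfin.toFinset \ (finite_forest_size_le d M).toFinset, ε ^ F.size • u F := by
      intro ε
      have hB : ∀ F ∈ (finite_forest_size_le d M).toFinset, ε ^ F.size •
          ((F.multiplicity : ℝ)⁻¹ * (F.map a).prod) • dirDeriv g (F.toList.map v) y =
          ε ^ F.size • u F := fun F hF => by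
        have hF' : Multiset.card F ≤ M := F.card_le_size.trans (by simpa using hF)
        simp only [hu, if_pos hF']
      rw [Finset.sum_congr rfl hB, sub_eq_iff_eq_add, ← Finset.union_sdiff_right,
        Finset.sum_sdiff Finset.subset_union_right]
      refine Finset.sum_subset Finset.subset_union_left fun F _ hF => ?_
      rw [(by simpa using hF : u F = 0), smul_zero]
    simp only [hrw]
    refine Asymptotics.IsBigO.fun_sum fun F hF => isBigO_pow_smul ?_ _
    have hF' : ¬ F.size ≤ M := by simpa using (Finset.mem_sdiff.1 hF).2
    omega
  refine (hO.add hrest).congr_left fun ε => ?_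
  simp only [Function.comp_apply, hpoly]
  abel

theorem hasSum_ite_of_finite {ι E : Type*} [NormedAddCommGroup E] {p : ι → Prop}
    [DecidablePred p] (hp : {i | p i}.Finite) (x : ι → E) :
    HasSum (fun i => if p i then x i else 0) (∑ i ∈ hp.toFinset, x i) := by
  have h := hasSum_sum_of_ne_finset_zero (f := fun i => if p i then x i else 0)
    (s := hp.toFinset) (L := .unconditional ι) fun i hi => if_neg (by simpa using hi)
  rwa [Finset.sum_congr rfl fun i hi => if_pos (by simpa using hi)] at h

theorem bTerm_dilate (f : Fin d → Space m → Space m) (y : Space m) (Z : HDual d) (ε : ℝ)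
    (τ : RTree d) : bTerm f y (Z.dilate ε) τ = ε ^ τ.size • bTerm f y Z τ := by
  have h : Forest.size {τ} = τ.size := by simp [Forest.size]
  rw [bTerm, bTerm, dilate_apply, h, smul_smul, mul_div_assoc]

theorem bSeriesTrunc_dilate (f : Fin d → Space m → Space m) (N : ℕ) (y : Space m) (Z : HDual d)
    (ε : ℝ) : bSeriesTrunc f N y (Z.dilate ε) =
      y + ∑ τ ∈ (finite_size_le d N).toFinset, ε ^ τ.size • bTerm f y Z τ := by
  rw [bSeriesTrunc, finsum_mem_eq_finite_toFinset_sum _ (finite_size_le d N)]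
  simp only [bTerm_dilate]

/-- The truncated form of the exchange of sums in `bSeries_comp`. Since `|τ| = |F| + |σ|` for every
nonzero grafting coefficient, the cut-off `|τ| ≤ N` becomes `|F| ≤ N - |σ|` and all sums are finite.
-/
theorem sum_bTerm_star (hf : ∀ a, ContDiff ℝ ∞ (f a)) (y : Space m) (Z₁ Z₂ : HDual d) (N : ℕ)
    (ε : ℝ) :
    ∑ τ ∈ (finite_size_le d N).toFinset, ε ^ τ.size •
        (bTerm f y (star Z₁ Z₂) τ - Z₂ 1 • bTerm f y Z₁ τ) =
      ∑ σ ∈ (finite_size_le d N).toFinset, (ε ^ σ.size * (Z₂ (ofForest {σ}) / σ.symmFactor)) •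
        ∑ F ∈ (finite_forest_size_le d (N - σ.size)).toFinset, ε ^ F.size •
          (Z₁ (ofForest F) / F.symmFactor) •
            dirDeriv (elemDiff f σ) (F.toList.map fun τ => elemDiff f τ y) y := by
  classical
  set T : RTree d × (Forest d × RTree d) → Space m := fun q =>
    if q.1.size ≤ N then ε ^ q.1.size • ((Z₁ (ofForest q.2.1) / q.2.1.symmFactor) *
      (Z₂ (ofForest {q.2.2}) / q.2.2.symmFactor)) •
        (simGraft q.2.1 {q.2.2}).coeff {q.1} • elemDiff f q.1 y else 0 with hT
  have hsize : ∀ (F : Forest d) (σ τ : RTree d), (simGraft F {σ}).coeff {τ} ≠ 0 →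
      τ.size = F.size + σ.size := fun F σ τ h => by
    simpa [Forest.size] using size_of_mem_simGraft h
  have hT' : ∀ τ F σ, T (τ, (F, σ)) = if F.size + σ.size ≤ N then
      (ε ^ (F.size + σ.size) * ((Z₁ (ofForest F) / F.symmFactor) *
        (Z₂ (ofForest {σ}) / σ.symmFactor))) •
          (simGraft F {σ}).coeff {τ} • elemDiff f τ y else 0 := by
    intro τ F σ
    by_cases h : (simGraft F {σ}).coeff {τ} = 0
    · simp [hT, h]
    · simp only [hT, hsize F σ τ h, smul_smul, mul_assoc]
  have hTs : Summable T := by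
    refine summable_of_ne_finset_zero (s := (finite_size_le d N).toFinset ×ˢ
      ((finite_forest_size_le d N).toFinset ×ˢ (finite_size_le d N).toFinset)) ?_
    rintro ⟨τ, F, σ⟩ h
    by_contra h₀
    rw [hT'] at h₀
    have h₁ : F.size + σ.size ≤ N := by
      by_contra h₁
      exact h₀ (if_neg h₁)
    have h₂ : (simGraft F {σ}).coeff {τ} ≠ 0 := by
      intro h₂
      simp [h₂] at h₀
    have h₃ := hsize F σ τ h₂
    refine h ?_
    simp only [Finset.mem_product, Set.Finite.mem_toFinset, Set.mem_ofPred_eq]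
    omega
  have h₁ := hTs.hasSum.prod_fiberwise (g := fun τ => if τ.size ≤ N then
      ε ^ τ.size • (bTerm f y (star Z₁ Z₂) τ - Z₂ 1 • bTerm f y Z₁ τ) else 0) fun τ => by
    by_cases hτ : τ.size ≤ N
    · simpa only [hT, if_pos hτ] using (hasSum_bTerm_star f y Z₁ Z₂ τ).const_smul (ε ^ τ.size)
    · simp only [hT, if_neg hτ]
      exact hasSum_zero
  have h₂ := (((Equiv.prodComm _ _).hasSum_iff (f := T)).2 hTs.hasSum).prod_fiberwise
    (g := fun p => if p.1.size + p.2.size ≤ N then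
      (ε ^ (p.1.size + p.2.size) * ((Z₁ (ofForest p.1) / p.1.symmFactor) *
        (Z₂ (ofForest {p.2}) / p.2.symmFactor))) •
          dirDeriv (elemDiff f p.2) (p.1.toList.map fun τ => elemDiff f τ y) y else 0) fun p => by
    simp only [Function.comp_def, Equiv.prodComm_apply, Prod.swap, hT']
    split_ifs
    · exact (hasSum_coeff_simGraft_smul_elemDiff hf y p.1 p.2).const_smul _
    · exact hasSum_zero
  have h₃ := (((Equiv.prodComm _ _).hasSum_iff).2 h₂).prod_fiberwise
    (g := fun σ => if σ.size ≤ N then (ε ^ σ.size * (Z₂ (ofForest {σ}) / σ.symmFactor)) •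
        ∑ F ∈ (finite_forest_size_le d (N - σ.size)).toFinset, ε ^ F.size •
          (Z₁ (ofForest F) / F.symmFactor) •
            dirDeriv (elemDiff f σ) (F.toList.map fun τ => elemDiff f τ y) y else 0) fun σ => by
    by_cases hσ : σ.size ≤ N
    · rw [if_pos hσ, Finset.smul_sum]
      refine (hasSum_ite_of_finite (finite_forest_size_le d (N - σ.size)) _).congr_fun fun F => ?_
      have hF : F.size + σ.size ≤ N ↔ F.size ≤ N - σ.size := by omega
      simp only [Function.comp_apply, Equiv.prodComm_apply, Prod.swap, hF, smul_smul]
      congr 2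
      ring
    · rw [if_neg hσ]
      refine hasSum_zero.congr_fun fun F => if_neg ?_
      simp only [Equiv.prodComm_apply, Prod.swap]
      omega
  exact ((hasSum_ite_of_finite (finite_size_le d N) _).unique h₁).trans
    (h₃.unique (hasSum_ite_of_finite (finite_size_le d N) _))

/-- The outer term of `σ` carries the factor `ε ^ |σ|`, so expanding `elemDiff f σ` up to order `N -
|σ|` suffices. -/
theorem isBigO_bSeriesTrunc_comp (hf : ∀ a, ContDiff ℝ ∞ (f a)) (y : Space m) {Z₁ Z₂ : HDual d}
    (hZ₁ : Z₁.IsCharacter) (hZ₂ : Z₂ 1 = 1) (N : ℕ) :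
    (fun ε : ℝ => bSeriesTrunc f N (bSeriesTrunc f N y (Z₁.dilate ε)) (Z₂.dilate ε) -
      bSeriesTrunc f N y ((star Z₁ Z₂).dilate ε)) =O[𝓝 0] fun ε : ℝ => ε ^ (N + 1) := by
  classical
  set S := (finite_size_le d N).toFinset with hS
  set a : RTree d → ℝ := fun τ => if τ ∈ S then Z₁ (ofForest {τ}) / τ.symmFactor else 0 with ha
  set h : ℝ → Space m := fun ε => ∑ τ ∈ S, ε ^ τ.size • bTerm f y Z₁ τ with hh
  have hcurve : ∀ ε, h ε = ∑ τ ∈ S, (ε ^ τ.size * a τ) • elemDiff f τ y := fun ε =>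
    Finset.sum_congr rfl fun τ hτ => by rw [ha, bTerm, smul_smul]; simp only [if_pos hτ]
  -- A forest with at most `N` vertices has only trees from `S`, so the truncation of the inner
  -- series does not alter its coefficient.
  have hA : ∀ F : Forest d, F.size ≤ N →
      (F.multiplicity : ℝ)⁻¹ * (F.map a).prod = Z₁ (ofForest F) / F.symmFactor := by
    intro F hF
    rw [hZ₁.apply_div_symmFactor]
    congr 2
    refine Multiset.map_congr rfl fun τ hτ => if_pos ?_
    simpa [hS] using (Forest.size_le_of_mem hτ).trans hF
  have key : ∀ σ ∈ S, (fun ε : ℝ => (ε ^ σ.size * (Z₂ (ofForest {σ}) / σ.symmFactor)) •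
      (elemDiff f σ (y + h ε) - ∑ F ∈ (finite_forest_size_le d (N - σ.size)).toFinset,
        ε ^ F.size • (Z₁ (ofForest F) / F.symmFactor) •
          dirDeriv (elemDiff f σ) (F.toList.map fun τ => elemDiff f τ y) y))
      =O[𝓝 0] fun ε : ℝ => ε ^ (N + 1) := by
    intro σ hσ
    have hσ' : σ.size ≤ N := by simpa [hS] using hσ
    have h₁ := isBigO_sum_forest (contDiff_elemDiff hf σ) y S a (fun τ hτ => if_neg hτ)
      (fun τ => elemDiff f τ y) (N - σ.size)
    have h₂ : (fun ε : ℝ => ε ^ σ.size * (Z₂ (ofForest {σ}) / σ.symmFactor)) =O[𝓝 0]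
        fun ε : ℝ => ε ^ σ.size := isBigO_pow_smul le_rfl _
    refine (h₂.smul h₁).congr (fun ε => ?_) fun ε => ?_
    · rw [hcurve]
      congr 2
      refine Finset.sum_congr rfl fun F hF => ?_
      have hF' : F.size ≤ N - σ.size := by simpa using hF
      rw [hA F (hF'.trans (Nat.sub_le _ _))]
    · rw [smul_eq_mul, ← pow_add]
      congr 1
      omega
  refine (Asymptotics.IsBigO.fun_sum (s := S) key).congr_left fun ε => ?_
  have hsum := sum_bTerm_star hf y Z₁ Z₂ N ε
  rw [hZ₂] at hsum
  simp only [one_smul, smul_sub, Finset.sum_sub_distrib, ← hS] at hsum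
  simp only [smul_sub, Finset.sum_sub_distrib]
  rw [← hsum, bSeriesTrunc_dilate, bSeriesTrunc_dilate, bSeriesTrunc_dilate, ← hS]
  have hb : ∑ σ ∈ S, ε ^ σ.size • bTerm f (y + h ε) Z₂ σ =
      ∑ σ ∈ S, (ε ^ σ.size * (Z₂ (ofForest {σ}) / σ.symmFactor)) • elemDiff f σ (y + h ε) :=
    Finset.sum_congr rfl fun σ _ => by rw [bTerm, smul_smul]
  rw [← hb]
  simp only [hh]
  abel

end BCK

end

theorem mainTheorem4 (d m : ℕ) (f : Fin d → BCK.Space m → BCK.Space m)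
    (hf : ∀ α, ContDiff ℝ ∞ (f α)) (y : BCK.Space m) (Z₁ Z₂ : BCK.HDual d)
    (hZ₁ : Z₁.IsCharacter) (hZ₂ : Z₂ 1 = 1) :
    (∀ N : ℕ,
      (fun ε : ℝ =>
          BCK.bSeriesTrunc f N (BCK.bSeriesTrunc f N y (Z₁.dilate ε)) (Z₂.dilate ε) -
            BCK.bSeriesTrunc f N y ((BCK.star Z₁ Z₂).dilate ε))
        =O[𝓝 0] fun ε : ℝ => ε ^ (N + 1)) ∧
    (∀ R : ℝ≥0∞,
      (∀ α, ∃ p : FormalMultilinearSeries ℝ (BCK.Space m) (BCK.Space m),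
        HasFPowerSeriesOnBall (f α) p y R) →
      BCK.BSeriesConverges f y (BCK.star Z₁.abs Z₂.abs) →
      BCK.bSeries f y Z₁ ∈ Metric.eball y R →
      BCK.BSeriesConverges f y Z₁ ∧
      BCK.BSeriesConverges f (BCK.bSeries f y Z₁) Z₂ ∧
      BCK.BSeriesConverges f y (BCK.star Z₁ Z₂) ∧
      BCK.bSeries f (BCK.bSeries f y Z₁) Z₂ = BCK.bSeries f y (BCK.star Z₁ Z₂)) := by
  refine ⟨BCK.isBigO_bSeriesTrunc_comp hf y hZ₁ hZ₂, fun R hR hs hB => ?_⟩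
  refine BCK.bSeries_comp hf y hZ₁ hZ₂ (fun a => ?_) hs hB
  obtain ⟨p, hp⟩ := hR a
  exact hp.analyticOnNhd
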